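/- Let $q$ be a prime power, let $K=\mathbb{F}_{q^2}$, and let $H=K(x,y)$, $y^q+y=x^{q+1}$, be the Hermitian function field over $K$. Let $\mathcal{P}$ be the (finite) set of rational places of $H/K$, i.e. of places of degree one, with normalized discrete valuations $v_P$ ($P\in\mathcal{P}$). Let $\mathcal{O}_{\mathcal{P}}^*$ be the group of all nonzero $f\in H$ whose divisor has support contained in $\mathcal{P}$; for such $f$ put $\deg f=\sum_{P\in\mathcal{P},\,v_P(f)>0}v_P(f)$. Let $L_{\mathcal{P}}=\{(v_P(f))_{P\in\mathcal{P}} : f\in\mathcal{O}_{\mathcal{P}}^*\}\subset\mathbb{Z}^{\mathcal{P}}\subset\mathbb{R}^{\mathcal{P}}$ be the Hermitian function field lattice. Then the minimum distance of $L_{\mathcal{P}}$, that is, the smallest Euclidean norm of a nonzero vector of $L_{\mathcal{P}}$, is equal to $\sqrt{2q}$, and the minimum of $\deg f$ over all non-constant functions $f\in\mathcal{O}_{\mathcal{P}}^*\setminus K$ is equal to $q$ (both minima are attained). -/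

import Mathlib

/-! ### Places, divisors and function field lattices -/

namespace FunctionFieldLattice

open IsDedekindDomain

variable (K F : Type*) [Field K] [Field F] [Algebra K F]

/-- A place of the function field `F / K`, given by its valuation ring: a discrete valuation ring
`K ⊆ 𝒪 ⊊ F` with field of fractions `F`. -/
structure Place where
  /-- the valuation ring of the place -/
  ring : ValuationSubring F
  algebraMap_mem : ∀ c : K, algebraMap K F c ∈ ring
  isDVR : IsDiscreteValuationRing ring

variable {K F}

namespace Place

instance (P : Place K F) : IsDiscreteValuationRing P.ring := P.isDVR

noncomputable instance (P : Place K F) : Algebra K P.ring :=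
  ((algebraMap K F).codRestrict P.ring P.algebraMap_mem).toAlgebra

/-- The degree of a place, `[𝒪_P / 𝔪_P : K]`. -/
noncomputable def degree (P : Place K F) : ℕ :=
  Module.finrank K (IsLocalRing.ResidueField P.ring)

/-- The `𝔪_P`-adic valuation, written multiplicatively. -/
noncomputable def val (P : Place K F) : Valuation F (WithZero (Multiplicative ℤ)) :=
  (IsDiscreteValuationRing.maximalIdeal P.ring).valuation F

/-- The normalized discrete valuation `v_P` on nonzero functions, as a homomorphism to `ℤ`. The
`𝔪_P`-adic valuation of Mathlib takes the value `exp (-1)` at a uniformizer, whence the sign. -/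
noncomputable def ord (P : Place K F) : Additive Fˣ →+ ℤ where
  toFun f := -WithZero.log (P.val (f.toMul : F))
  map_zero' := by simp
  map_add' f g := by
    have hf : P.val (f.toMul : F) ≠ 0 := (Valuation.ne_zero_iff _).2 f.toMul.ne_zero
    have hg : P.val (g.toMul : F) ≠ 0 := (Valuation.ne_zero_iff _).2 g.toMul.ne_zero
    rw [toMul_add, Units.val_mul, map_mul, WithZero.log_mul hf hg, neg_add]

end Place

variable (K F)

/-- The rational places of `F / K`, that is, the places of degree one. -/
def RationalPlace : Type _ := {P : Place K F // P.degree = 1}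

/-- The group `𝒪_𝒫^*` of all nonzero functions whose divisor is supported in the set of rational
places (written additively). -/
def rationalUnits : AddSubgroup (Additive Fˣ) where
  carrier := {f | ∀ P : Place K F, P.ord f ≠ 0 → P.degree = 1}
  zero_mem' P h := absurd (map_zero _) h
  add_mem' {f g} hf hg P h := by
    by_cases h0 : P.ord f = 0
    · exact hg P fun h1 => h (by rw [map_add, h0, h1, add_zero])
    · exact hf P h0
  neg_mem' {f} hf P h := hf P fun h1 => h (by rw [map_neg, h1, neg_zero])

section

variable [Fintype (RationalPlace K F)]

variable {K F} in
/-- The degree of a function in `𝒪_𝒫^*`: the sum of its positive valuations at rational places. -/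
noncomputable def functionDegree (f : rationalUnits K F) : ℤ :=
  ∑ P : RationalPlace K F, if 0 < P.1.ord f.1 then P.1.ord f.1 else 0

/-- The homomorphism `f ↦ (v_P(f))_P` from `𝒪_𝒫^*` to `ℤ^n ⊆ ℝ^n`, where `n` is the number of
rational places. -/
noncomputable def divisorVector :
    rationalUnits K F →+ EuclideanSpace ℝ (RationalPlace K F) where
  toFun f := WithLp.toLp 2 fun P => ((P.1.ord f.1 : ℤ) : ℝ)
  map_zero' := by ext P; simp
  map_add' f g := by ext P; simp

/-- The function field lattice `L_𝒫`. -/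
noncomputable def lattice : AddSubgroup (EuclideanSpace ℝ (RationalPlace K F)) :=
  (divisorVector K F).range

end

/-! ### A place is determined by the point of a plane model at which it is centered -/

section

variable {K F}

namespace Place

theorem ext' {P Q : Place K F} (h : ∀ z, z ∈ P.ring ↔ z ∈ Q.ring) : P = Q := by
  have : P.ring = Q.ring := by ext z; exact h z
  cases P; cases Q; cases this; rfl

theorem mem_ring_iff (P : Place K F) (z : F) : z ∈ P.ring ↔ P.val z ≤ 1 := by
  constructor
  · intro h
    exact HeightOneSpectrum.valuation_le_one (K := F) (IsDiscreteValuationRing.maximalIdeal P.ring)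
      (⟨z, h⟩ : P.ring)
  · intro h
    obtain ⟨w, rfl⟩ := IsDiscreteValuationRing.exists_lift_of_le_one (A := P.ring) h
    exact w.2

theorem val_lt_one_iff (P : Place K F) (z : P.ring) :
    P.val (z : F) < 1 ↔ IsLocalRing.residue P.ring z = 0 := by
  have := HeightOneSpectrum.valuation_lt_one_iff_mem (K := F)
    (IsDiscreteValuationRing.maximalIdeal P.ring) z
  rw [IsLocalRing.residue_eq_zero_iff]
  exact this

theorem val_algebraMap (P : Place K F) {c : K} (hc : c ≠ 0) : P.val (algebraMap K F c) = 1 := by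
  have h1 := (P.mem_ring_iff _).1 (P.algebraMap_mem c)
  have h2 := (P.mem_ring_iff _).1 (P.algebraMap_mem c⁻¹)
  refine le_antisymm h1 ?_
  rw [map_inv₀, map_inv₀] at h2
  have h3 : P.val (algebraMap K F c) ≠ 0 := by simpa using hc
  exact (inv_le_one₀ (zero_lt_iff.2 h3)).1 h2

theorem exists_const (P : Place K F) (hP : P.degree = 1) (z : F) (hz : P.val z ≤ 1) :
    ∃ c : K, P.val (z - algebraMap K F c) < 1 := by
  have hz' := (P.mem_ring_iff z).2 hz
  have hs : Function.Surjective (algebraMap K (IsLocalRing.ResidueField P.ring)) := by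
    intro w
    obtain ⟨c, hc⟩ := (finrank_eq_one_iff_of_nonzero' (1 : IsLocalRing.ResidueField P.ring)
      one_ne_zero).1 hP w
    exact ⟨c, by rw [← hc, Algebra.smul_def, mul_one]⟩
  obtain ⟨c, hc⟩ := hs (IsLocalRing.residue P.ring ⟨z, hz'⟩)
  refine ⟨c, ?_⟩
  have h := (P.val_lt_one_iff (⟨z, hz'⟩ - algebraMap K P.ring c)).2 (by
    rw [map_sub, ← hc]; exact sub_self _)
  exact h

theorem exists_decomp {t u e r : F} (he : e ∈ Algebra.adjoin K {t, u})
    (hr : r ∈ Algebra.adjoin K {t, u}) (h : u * e = t * r) (P Q : Place K F)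
    (hPt : P.val t < 1) (hPu : P.val u < 1) (hPe : P.val e = 1)
    (hQt : Q.val t < 1) (hQu : Q.val u < 1) (hQe : Q.val e = 1) (n : ℕ) :
    ∀ g ∈ Algebra.adjoin K {t, u}, g ≠ 0 → WithZero.exp (-(n : ℤ)) ≤ P.val g →
      ∃ (k : ℕ) (w : F), P.val w = 1 ∧ Q.val w = 1 ∧ g = t ^ k * w := by
  have hle : ∀ (P : Place K F), P.val t < 1 → P.val u < 1 →
      ∀ g ∈ Algebra.adjoin K {t, u}, P.val g ≤ 1 := by
    intro P ht hu g hg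
    rw [← mem_ring_iff]
    induction hg using Algebra.adjoin_induction with
    | mem x hx =>
      rcases hx with rfl | rfl
      · exact (P.mem_ring_iff _).2 ht.le
      · exact (P.mem_ring_iff _).2 hu.le
    | algebraMap c => exact P.algebraMap_mem c
    | add x y _ _ hx hy => exact add_mem hx hy
    | mul x y _ _ hx hy => exact mul_mem hx hy
  have hdec : ∀ g ∈ Algebra.adjoin K {t, u}, ∃ (c : K), ∃ a ∈ Algebra.adjoin K {t, u},
      ∃ b ∈ Algebra.adjoin K {t, u}, g = algebraMap K F c + (t * a + u * b) := by
    intro g hg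
    induction hg using Algebra.adjoin_induction with
    | mem x hx =>
      rcases hx with rfl | rfl
      · exact ⟨0, 1, one_mem _, 0, zero_mem _, by simp⟩
      · exact ⟨0, 0, zero_mem _, 1, one_mem _, by simp⟩
    | algebraMap c => exact ⟨c, 0, zero_mem _, 0, zero_mem _, by simp⟩
    | add x y _ _ hx hy =>
      obtain ⟨c, a, ha, b, hb, rfl⟩ := hx
      obtain ⟨c', a', ha', b', hb', rfl⟩ := hy
      exact ⟨c + c', a + a', add_mem ha ha', b + b', add_mem hb hb', by rw [map_add]; ring⟩
    | mul x y _ hy' hx hy =>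
      obtain ⟨c, a, ha, b, hb, rfl⟩ := hx
      obtain ⟨c', a', ha', b', hb', h'⟩ := hy
      refine ⟨c * c', a * y + algebraMap K F c * a',
        add_mem (mul_mem ha hy') (mul_mem (Subalgebra.algebraMap_mem _ c) ha'),
        b * y + algebraMap K F c * b',
        add_mem (mul_mem hb hy') (mul_mem (Subalgebra.algebraMap_mem _ c) hb'), ?_⟩
      rw [map_mul]
      linear_combination (algebraMap K F c) * h'
  have hunit : ∀ (P : Place K F), P.val t < 1 → P.val u < 1 →
      ∀ c : K, c ≠ 0 → ∀ a ∈ Algebra.adjoin K {t, u}, ∀ b ∈ Algebra.adjoin K {t, u},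
      P.val (algebraMap K F c + (t * a + u * b)) = 1 := by
    intro P ht hu c hc a ha b hb
    rw [← P.val_algebraMap hc]
    apply Valuation.map_add_eq_of_lt_left
    rw [P.val_algebraMap hc]
    refine Valuation.map_add_lt _ ?_ ?_
    · rw [map_mul]; exact mul_lt_one_of_lt_of_le ht (hle P ht hu a ha)
    · rw [map_mul]; exact mul_lt_one_of_lt_of_le hu (hle P ht hu b hb)
  have he0 : e ≠ 0 := by rintro rfl; simp at hPe
  induction n with
  | zero =>
    intro g hg hg0 hv
    have h1 : P.val g = 1 := le_antisymm (hle P hPt hPu g hg) (by simpa using hv)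
    obtain ⟨c, a, ha, b, hb, rfl⟩ := hdec g hg
    by_cases hc : c = 0
    · exfalso
      subst hc
      refine absurd h1 (ne_of_lt ?_)
      rw [map_zero, zero_add]
      refine Valuation.map_add_lt _ ?_ ?_
      · rw [map_mul]; exact mul_lt_one_of_lt_of_le hPt (hle P hPt hPu a ha)
      · rw [map_mul]; exact mul_lt_one_of_lt_of_le hPu (hle P hPt hPu b hb)
    · exact ⟨0, _, h1, hunit Q hQt hQu c hc a ha b hb, by simp⟩
  | succ n ih =>
    intro g hg hg0 hv
    obtain ⟨c, a, ha, b, hb, hgd⟩ := hdec g hg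
    by_cases hc : c = 0
    · subst hc
      rw [map_zero, zero_add] at hgd
      have hge : g * e = t * (a * e + b * r) := by rw [hgd]; linear_combination b * h
      have hne : a * e + b * r ≠ 0 := by
        intro h0
        rw [h0, mul_zero] at hge
        exact (mul_ne_zero hg0 he0) hge
      have hvg : P.val g = P.val t * P.val (a * e + b * r) := by
        rw [← map_mul, ← hge, map_mul, hPe, mul_one]
      have hvt : P.val t ≤ WithZero.exp (-1 : ℤ) := by
        by_cases ht0 : P.val t = 0
        · rw [ht0]; exact zero_le
        · rw [← WithZero.log_le_iff_le_exp ht0]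
          have := (WithZero.log_lt_iff_lt_exp (a := 0) ht0).2 (by simpa using hPt)
          omega
      obtain ⟨k, w, hw, hw', hk⟩ := ih (a * e + b * r) (add_mem (mul_mem ha he) (mul_mem hb hr)) hne
        (by
          have h1 : WithZero.exp (-((n + 1 : ℕ) : ℤ)) ≤
              WithZero.exp (-1 : ℤ) * P.val (a * e + b * r) :=
            hv.trans (hvg.le.trans (mul_le_mul_left hvt _))
          have h2 : WithZero.exp (-((n + 1 : ℕ) : ℤ)) =
              WithZero.exp (-1 : ℤ) * WithZero.exp (-(n : ℤ)) := by
            rw [← WithZero.exp_add]; congr 1; push_cast; ring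
          rw [h2] at h1
          exact (mul_le_mul_iff_right₀ (zero_lt_iff.2 WithZero.exp_ne_zero)).1 h1)
      refine ⟨k + 1, w / e, by simp [hw, hPe], by simp [hw', hQe], ?_⟩
      field_simp
      rw [hge, hk]; ring
    · refine ⟨0, g, ?_, ?_, by simp⟩
      · rw [hgd]; exact hunit P hPt hPu c hc a ha b hb
      · rw [hgd]; exact hunit Q hQt hQu c hc a ha b hb

/-- Two places centered at the same nonsingular point of a plane model are equal. -/
theorem eq_of_center {t u e r : F} (hgen : IntermediateField.adjoin K {t, u} = ⊤)
    (he : e ∈ Algebra.adjoin K {t, u}) (hr : r ∈ Algebra.adjoin K {t, u}) (h : u * e = t * r)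
    (P Q : Place K F)
    (hPt : P.val t < 1) (hPu : P.val u < 1) (hPe : P.val e = 1)
    (hQt : Q.val t < 1) (hQu : Q.val u < 1) (hQe : Q.val e = 1) : P = Q := by
  have key : ∀ g ∈ Algebra.adjoin K {t, u}, g ≠ 0 →
      ∃ (k : ℕ) (w : F), P.val w = 1 ∧ Q.val w = 1 ∧ g = t ^ k * w := by
    intro g hg hg0
    have hv : P.val g ≠ 0 := (Valuation.ne_zero_iff _).2 hg0
    refine exists_decomp he hr h P Q hPt hPu hPe hQt hQu hQe (WithZero.log (P.val g)).natAbs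
      g hg hg0 ?_
    rw [← WithZero.exp_log hv, WithZero.exp_le_exp, WithZero.log_exp]
    omega
  refine ext' fun z => ?_
  rw [mem_ring_iff, mem_ring_iff]
  by_cases hz : z = 0
  · simp [hz]
  have hzm : z ∈ IntermediateField.adjoin K {t, u} := hgen ▸ IntermediateField.mem_top
  obtain ⟨a, ha, b, hb, rfl⟩ := IntermediateField.mem_adjoin_iff_div.1 hzm
  have ha0 : a ≠ 0 := fun h => hz (by simp [h])
  have hb0 : b ≠ 0 := fun h => hz (by simp [h])
  obtain ⟨k, w, hw, hw', rfl⟩ := key a ha ha0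
  obtain ⟨l, w₂, hw₂, hw₂', rfl⟩ := key b hb hb0
  simp only [map_div₀, map_mul, map_pow, hw, hw', hw₂, hw₂', mul_one]
  by_cases ht : t = 0
  · have hk : k = 0 := by by_contra hk; simp [ht, hk] at ha0
    have hl : l = 0 := by by_contra hl; simp [ht, hl] at hb0
    simp [hk, hl]
  have main : ∀ P : Place K F, P.val t < 1 → (P.val t ^ k / P.val t ^ l ≤ 1 ↔ l ≤ k) := by
    intro P hP
    have hp : 0 < P.val t := zero_lt_iff.2 ((Valuation.ne_zero_iff _).2 ht)
    rw [div_le_one₀ (pow_pos hp l), pow_le_pow_iff_right_of_lt_one₀ hp hP]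
  rw [main P hPt, main Q hQt]

end Place

end

end FunctionFieldLattice

/-! ### The Hermitian function field -/

section

open Polynomial

variable (K : Type*) [Field K] (q : ℕ)

/-- The polynomial `X^(q+1) - (y^q + y)` over the rational function field `K(y)`. -/
noncomputable def hermitianPoly : (RatFunc K)[X] :=
  X ^ (q + 1) - C (RatFunc.X ^ q + RatFunc.X)

/-- The Hermitian function field `H = K(x, y)`, `y^q + y = x^(q+1)`, as the extension of the
rational function field `K(y)` obtained by adjoining a root `x` of `X^(q+1) - (y^q + y)`. -/
abbrev HermitianFunctionField : Type _ := AdjoinRoot (hermitianPoly K q)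

theorem hermitianPoly_irreducible (hq : 2 ≤ q) : Irreducible (hermitianPoly K q) := by
  set f : K[X][X] := X ^ (q + 1) - C (X ^ q + X) with hf
  have hmap : f.map (algebraMap K[X] (RatFunc K)) = hermitianPoly K q := by
    simp [hf, hermitianPoly, RatFunc.algebraMap_X]
  have hmonic : f.Monic := monic_X_pow_sub_C _ (Nat.succ_ne_zero q)
  have hdeg : f.natDegree = q + 1 := natDegree_X_pow_sub_C
  rw [← hmap, ← hmonic.irreducible_iff_irreducible_map_fraction_map]
  have hprime : (Ideal.span {(X : K[X])}).IsPrime :=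
    (Ideal.span_singleton_prime X_ne_zero).2 prime_X
  refine irreducible_of_eisenstein_criterion hprime ?_ ?_ ?_ ?_ hmonic.isPrimitive
  · rw [hmonic.leadingCoeff, ← Ideal.eq_top_iff_one]
    exact hprime.ne_top
  · intro n hn
    have hn' : n < q + 1 := by
      have := degree_eq_natDegree hmonic.ne_zero
      rw [this, hdeg] at hn
      exact_mod_cast hn
    rw [hf, coeff_sub, coeff_X_pow, if_neg hn'.ne, zero_sub, coeff_C]
    split_ifs with h0
    · rw [neg_mem_iff, Ideal.mem_span_singleton]
      exact dvd_add (dvd_pow_self _ (by omega)) dvd_rfl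
    · simp
  · rw [degree_eq_natDegree hmonic.ne_zero, hdeg]
    exact_mod_cast Nat.succ_pos q
  · rw [Ideal.span_singleton_pow, Ideal.mem_span_singleton, hf, coeff_sub, coeff_X_pow,
      if_neg (Nat.succ_ne_zero q).symm, zero_sub, coeff_C_zero, dvd_neg, X_pow_dvd_iff]
    intro h
    have := h 1 (by norm_num)
    rw [coeff_add, coeff_X_pow, if_neg (by omega), coeff_X_one, zero_add] at this
    exact one_ne_zero this

instance hermitianPoly_fact [hq : Fact (IsPrimePow q)] : Fact (Irreducible (hermitianPoly K q)) :=
  ⟨hermitianPoly_irreducible K q hq.out.two_le⟩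

namespace HermitianFunctionField

open FunctionFieldLattice

/-- The generator `x`. -/
noncomputable def x : HermitianFunctionField K q := AdjoinRoot.root _

/-- The generator `y`. -/
noncomputable def y : HermitianFunctionField K q := AdjoinRoot.of _ RatFunc.X

theorem equation : y K q ^ q + y K q = x K q ^ (q + 1) := by
  have h : AdjoinRoot.mk (hermitianPoly K q) (X ^ (q + 1) - C (RatFunc.X ^ q + RatFunc.X)) = 0 :=
    AdjoinRoot.mk_self
  rw [map_sub, map_pow, AdjoinRoot.mk_X, AdjoinRoot.mk_C, map_add, map_pow, sub_eq_zero] at h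
  exact h.symm

variable [Fact (IsPrimePow q)]

theorem adjoin_eq_top (L : IntermediateField K (HermitianFunctionField K q))
    (hx : x K q ∈ L) (hy : y K q ∈ L) : L = ⊤ := by
  rw [eq_top_iff]
  have hof : ∀ z : RatFunc K, AdjoinRoot.of (hermitianPoly K q) z ∈ L := by
    intro z
    have hpoly : ∀ p : K[X], AdjoinRoot.of (hermitianPoly K q) (algebraMap K[X] (RatFunc K) p) ∈ L := by
      intro p
      induction p using Polynomial.induction_on' with
      | add p r hp hr => rw [map_add, map_add]; exact add_mem hp hr
      | monomial n a =>
        rw [← C_mul_X_pow_eq_monomial, map_mul, map_mul, map_pow, map_pow, RatFunc.algebraMap_X]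
        refine mul_mem ?_ (pow_mem hy n)
        rw [RatFunc.algebraMap_C]
        exact L.algebraMap_mem a
    rw [← RatFunc.num_div_denom z, map_div₀]
    exact div_mem (hpoly _) (hpoly _)
  intro z _
  obtain ⟨p, rfl⟩ := AdjoinRoot.mk_surjective z
  induction p using Polynomial.induction_on' with
  | add p r hp hr =>
    rw [map_add]
    exact add_mem (hp IntermediateField.mem_top) (hr IntermediateField.mem_top)
  | monomial n a =>
    rw [← C_mul_X_pow_eq_monomial, map_mul, map_pow, AdjoinRoot.mk_C, AdjoinRoot.mk_X]
    exact mul_mem (hof a) (pow_mem hx n)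

variable [hK : Fact (Nat.card K = q ^ 2)]

theorem frobenius_add (F : Type*) [Field F] [Algebra K F] (a b : F) :
    (a + b) ^ q = a ^ q + b ^ q := by
  have hq : 2 ≤ q := (Fact.out : IsPrimePow q).two_le
  have : Finite K := Nat.finite_of_card_ne_zero (by rw [hK.out]; positivity)
  have := Fintype.ofFinite K
  obtain ⟨p, hp, n, hpr, hc⟩ := FiniteField.card' K
  rw [← Nat.card_eq_fintype_card, hK.out] at hc
  obtain ⟨k, -, hk⟩ := (Nat.dvd_prime_pow hpr).1 (hc ▸ dvd_pow_self q two_ne_zero : q ∣ p ^ (n : ℕ))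
  have := Fact.mk hpr
  have : CharP F p := charP_of_injective_algebraMap (algebraMap K F).injective p
  rw [hk, add_pow_char_pow]

/-- The Hermitian function field has only finitely many rational places: they are determined by
their center on the projective curve. -/
instance finite_rationalPlace : Finite (RationalPlace K (HermitianFunctionField K q)) := by
  have hq : 2 ≤ q := (Fact.out : IsPrimePow q).two_le
  have : Finite K := Nat.finite_of_card_ne_zero (by rw [hK.out]; positivity)
  set H := HermitianFunctionField K q
  set X := x K q with hX
  set Y := y K q with hY
  have heq : Y ^ q + Y = X ^ (q + 1) := equation K q
  have hval : ∀ (P : Place K H) (u : H), P.val u < 1 → P.val (1 + u ^ (q - 1)) = 1 := by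
    intro P u hu
    have h1 : P.val (u ^ (q - 1)) < P.val 1 := by
      rw [map_pow, map_one]; exact pow_lt_one₀ zero_le hu (by omega)
    rw [Valuation.map_add_eq_of_lt_left _ h1, map_one]
  have hpow : ∀ u : H, u * (1 + u ^ (q - 1)) = u + u ^ q := by
    intro u
    obtain ⟨m, rfl⟩ : ∃ m, q = m + 1 := ⟨q - 1, by omega⟩
    simp only [Nat.add_sub_cancel]; ring
  -- the center of a place
  let center : Place K H → Option (K × K) → Prop := fun P o => match o with
    | none => 1 < P.val Y
    | some (a, b) => P.val (X - algebraMap K H a) < 1 ∧ P.val (Y - algebraMap K H b) < 1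
  have hex : ∀ P : RationalPlace K H, ∃ o, center P.1 o := by
    rintro ⟨P, hP⟩
    by_cases hy : P.val Y ≤ 1
    · have hx : P.val X ≤ 1 := by
        have h1 : P.val (X ^ (q + 1)) ≤ 1 := by
          rw [← heq, ← Place.mem_ring_iff]
          rw [← Place.mem_ring_iff] at hy
          exact add_mem (pow_mem hy q) hy
        rw [map_pow] at h1
        exact (pow_le_one_iff_of_nonneg zero_le (Nat.succ_ne_zero q)).1 h1
      obtain ⟨a, ha⟩ := P.exists_const hP X hx
      obtain ⟨b, hb⟩ := P.exists_const hP Y hy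
      exact ⟨some (a, b), ha, hb⟩
    · exact ⟨none, not_le.1 hy⟩
  have huniq : ∀ (o : Option (K × K)) (P Q : Place K H), center P o → center Q o → P = Q := by
    rintro (_ | ⟨a, b⟩) P Q hP hQ
    · change 1 < P.val Y at hP
      change 1 < Q.val Y at hQ
      have hY0 : Y ≠ 0 := by
        intro h; rw [h, map_zero] at hP; exact absurd hP (not_lt.2 zero_le)
      have hrel : Y⁻¹ * (1 + Y⁻¹ ^ (q - 1)) = (X * Y⁻¹) * (X * Y⁻¹) ^ q := by
        rw [hpow, ← pow_succ', mul_pow, ← heq]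
        have e1 : Y * Y⁻¹ = 1 := mul_inv_cancel₀ hY0
        have e2 : Y ^ q * Y⁻¹ ^ q = 1 := by rw [← mul_pow, e1, one_pow]
        rw [pow_succ]
        linear_combination (-Y⁻¹) * e2 - Y⁻¹ ^ q * e1
      have hs : ∀ P : Place K H, 1 < P.val Y → P.val Y⁻¹ < 1 := by
        intro P hP
        rw [map_inv₀]; exact inv_lt_one_of_one_lt₀ hP
      have hw : ∀ P : Place K H, 1 < P.val Y → P.val (X * Y⁻¹) < 1 := by
        intro P hP
        have h1 : P.val (X * Y⁻¹) ^ (q + 1) < 1 := by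
          rw [← map_pow, pow_succ', ← hrel, map_mul, hval P _ (hs P hP), mul_one]
          exact hs P hP
        exact (pow_lt_one_iff_of_nonneg zero_le (Nat.succ_ne_zero q)).1 h1
      have hYm : Y⁻¹ ∈ Algebra.adjoin K {X * Y⁻¹, Y⁻¹} := Algebra.subset_adjoin (by simp)
      have hXm : X * Y⁻¹ ∈ Algebra.adjoin K {X * Y⁻¹, Y⁻¹} := Algebra.subset_adjoin (by simp)
      refine Place.eq_of_center (t := X * Y⁻¹) (u := Y⁻¹) ?_
        (add_mem (one_mem _) (pow_mem hYm _)) (pow_mem hXm q) hrel P Q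
        (hw P hP) (hs P hP) (hval P _ (hs P hP)) (hw Q hQ) (hs Q hQ) (hval Q _ (hs Q hQ))
      have hy' : Y ∈ IntermediateField.adjoin K {X * Y⁻¹, Y⁻¹} := by
        rw [← inv_inv Y]
        refine inv_mem (IntermediateField.subset_adjoin _ _ ?_)
        simp
      refine adjoin_eq_top K q _ ?_ hy'
      have : X = (X * Y⁻¹) * Y := by field_simp
      have hw' : X * Y⁻¹ ∈ IntermediateField.adjoin K {X * Y⁻¹, Y⁻¹} :=
        IntermediateField.subset_adjoin _ _ (by simp)
      have hm := mul_mem hw' hy'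
      rwa [← this] at hm
    · obtain ⟨hP1, hP2⟩ := hP
      obtain ⟨hQ1, hQ2⟩ := hQ
      set A := algebraMap K H a
      set B := algebraMap K H b
      set t := X - A with ht
      set u := Y - B with hu
      -- the point `(a, b)` lies on the curve
      have hcurve : B ^ q + B = A ^ (q + 1) := by
        by_contra hne
        have hc : b ^ q + b - a ^ (q + 1) ≠ 0 := by
          intro h0
          apply hne
          rw [← sub_eq_zero, ← map_pow, ← map_pow, ← map_add, ← map_sub, h0, map_zero]
        have h1 := P.val_algebraMap hc
        have h2 : algebraMap K H (b ^ q + b - a ^ (q + 1)) =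
            -(u ^ q + u) + (t * t ^ q + t * A ^ q + A * t ^ q) := by
          have e1 : Y ^ q = u ^ q + B ^ q := by rw [← frobenius_add K q]; simp [hu]
          have e2 : X ^ q = t ^ q + A ^ q := by rw [← frobenius_add K q]; simp [ht]
          rw [map_sub, map_add, map_pow, map_pow]
          rw [e1, pow_succ, e2] at heq
          have e3 : Y = u + B := by simp [hu]
          have e4 : X = t + A := by simp [ht]
          rw [e3, e4] at heq
          rw [pow_succ]
          linear_combination heq
        have hA : P.val A ≤ 1 := (P.mem_ring_iff _).1 (P.algebraMap_mem a)
        have hq0 : q ≠ 0 := by omega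
        have htq : P.val (t ^ q) < 1 := by rw [map_pow]; exact pow_lt_one₀ zero_le hP1 hq0
        have huq : P.val (u ^ q) < 1 := by rw [map_pow]; exact pow_lt_one₀ zero_le hP2 hq0
        have hAq : P.val (A ^ q) ≤ 1 := by rw [map_pow]; exact pow_le_one₀ zero_le hA
        refine absurd h1 (ne_of_lt ?_)
        rw [h2]
        refine Valuation.map_add_lt _ ?_ (Valuation.map_add_lt _ (Valuation.map_add_lt _ ?_ ?_) ?_)
        · rw [Valuation.map_neg]; exact Valuation.map_add_lt _ huq hP2
        · rw [map_mul]; exact mul_lt_one_of_lt_of_le hP1 htq.le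
        · rw [map_mul]; exact mul_lt_one_of_lt_of_le hP1 hAq
        · rw [mul_comm, map_mul]; exact mul_lt_one_of_lt_of_le htq hA
      have htm : t ∈ Algebra.adjoin K {t, u} := Algebra.subset_adjoin (by simp)
      have hum : u ∈ Algebra.adjoin K {t, u} := Algebra.subset_adjoin (by simp)
      have hAm : A ∈ Algebra.adjoin K {t, u} := Subalgebra.algebraMap_mem _ a
      have hrel : u * (1 + u ^ (q - 1)) = t * (t ^ q + A ^ q + A * t ^ (q - 1)) := by
        have e0 : t * t ^ (q - 1) = t ^ q := by rw [← pow_succ']; congr 1; omega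
        have e1 : Y ^ q = u ^ q + B ^ q := by rw [← frobenius_add K q]; simp [hu]
        have e2 : X ^ q = t ^ q + A ^ q := by rw [← frobenius_add K q]; simp [ht]
        have e3 : Y = u + B := by simp [hu]
        have e4 : X = t + A := by simp [ht]
        rw [hpow]
        rw [e1, pow_succ, e2] at heq
        rw [e3, e4] at heq
        rw [pow_succ] at hcurve
        linear_combination heq - hcurve - A * e0
      refine Place.eq_of_center (t := t) (u := u) ?_ (add_mem (one_mem _) (pow_mem hum _))
        (add_mem (add_mem (pow_mem htm q) (pow_mem hAm q)) (mul_mem hAm (pow_mem htm _))) hrel P Q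
        hP1 hP2 (hval P _ hP2) hQ1 hQ2 (hval Q _ hQ2)
      refine adjoin_eq_top K q _ ?_ ?_
      · have : X = t + A := by simp [ht]
        rw [← hX, this]
        exact add_mem (IntermediateField.subset_adjoin _ _ (by simp))
          (IntermediateField.algebraMap_mem _ a)
      · have : Y = u + B := by simp [hu]
        rw [← hY, this]
        exact add_mem (IntermediateField.subset_adjoin _ _ (by simp))
          (IntermediateField.algebraMap_mem _ b)
  choose φ hφ using hex
  refine Finite.of_injective φ fun P Q h => Subtype.ext (huniq (φ P) P.1 Q.1 (hφ P) ?_)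
  rw [h]; exact hφ Q

noncomputable instance : Fintype (RationalPlace K (HermitianFunctionField K q)) :=
  Fintype.ofFinite _

end HermitianFunctionField

end

/-!
The Hermitian equation is preserved by the substitutions which move a rational point `(a, b)` of the
affine curve, or the point at infinity, to the origin: `(x - a, y + b^q - a^q x)` and `(x/y, 1/y)` are
again pairs of generators satisfying it. So the notion studied below is that of a Hermitian pair
(`IsHermitianPair`) in an abstract field `F / K`, and local statements need a proof only at the origin,
where `x` is a uniformizer and `y` has valuation `q + 1`. Hence the tangent line at a rational point
`P` of the affine curve has divisor `(q + 1) (P - ∞)` (`IsHermitianPair.exists_divisor`).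

Two global facts are needed. The coordinate ring `K[x, y]` is a Dedekind domain, since
`T^q + T - x^(q+1)` has derivative `1`; so a function without poles outside `∞` is a polynomial in `x`
and `y`. And such a polynomial is constant if it has no pole at `∞` either, since the monomials
`x^i y^j`, `i ≤ q`, have distinct pole orders there. Multiplying `g^(q+1)` by powers of tangent lines,
one moves all its rational zeros and poles to `∞` and finds that the sum of `v_P(g)` over the rational
places is at most `0` whenever all poles of `g` are rational (`IsHermitianPair.sum_ord_nonpos`). This
replaces the theorem that principal divisors have degree `0`, and gives the product formula for
functions `f` supported in the rational places.

Let such an `f` be nonconstant of degree `d`. The inequality, applied to `f - c` for a constant `c`,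
says that `f` takes the value `c` at no more than `d` rational places, and it has no more than `d`
poles. There are at least `q^3` rational places, and `K ∪ {∞}` has `q^2 + 1` elements, so
`q^3 ≤ (q^2 + 1) d`, which forces `d ≥ q`. For a vector of the lattice, the squared norm is at least
the sum of the absolute values of the coordinates, that is `2 d ≥ 2 q`. Both bounds are attained by
`x / (x - 1)`, which has `q` simple zeros, `q` simple poles, and neither at other places.
-/

/-! ### Places and their valuations -/

namespace FunctionFieldLattice

open IsDedekindDomain

section

variable {K F : Type*} [Field K] [Field F] [Algebra K F]

namespace Place

theorem val_toMul (P : Place K F) (f : Additive Fˣ) :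
    P.val (f.toMul : F) = WithZero.exp (-(P.ord f)) := by
  have hf : P.val (f.toMul : F) ≠ 0 := (Valuation.ne_zero_iff _).2 f.toMul.ne_zero
  change _ = WithZero.exp (-(-WithZero.log (P.val (f.toMul : F))))
  rw [neg_neg, WithZero.exp_log hf]

theorem val_le_one_iff_ord (P : Place K F) (f : Additive Fˣ) :
    P.val (f.toMul : F) ≤ 1 ↔ 0 ≤ P.ord f := by
  rw [val_toMul, ← WithZero.exp_zero, WithZero.exp_le_exp]; omega

theorem val_lt_one_iff_ord (P : Place K F) (f : Additive Fˣ) :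
    P.val (f.toMul : F) < 1 ↔ 0 < P.ord f := by
  rw [val_toMul, ← WithZero.exp_zero, WithZero.exp_lt_exp]; omega

theorem one_lt_val_iff_ord (P : Place K F) (f : Additive Fˣ) :
    1 < P.val (f.toMul : F) ↔ P.ord f < 0 := by
  rw [val_toMul, ← WithZero.exp_zero, WithZero.exp_lt_exp]; omega

theorem val_algebraMap_le_one (P : Place K F) (c : K) : P.val (algebraMap K F c) ≤ 1 :=
  (P.mem_ring_iff _).1 (P.algebraMap_mem c)

theorem val_le_one_of_mem_adjoin (P : Place K F) {s : Set F} (hs : ∀ z ∈ s, P.val z ≤ 1) {g : F}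
    (hg : g ∈ Algebra.adjoin K s) : P.val g ≤ 1 := by
  rw [← mem_ring_iff]
  induction hg using Algebra.adjoin_induction with
  | mem x hx => exact (P.mem_ring_iff _).2 (hs x hx)
  | algebraMap c => exact P.algebraMap_mem c
  | add x y _ _ hx hy => exact add_mem hx hy
  | mul x y _ _ hx hy => exact mul_mem hx hy

/-- Some function is a uniformizer of `P`. -/
theorem exists_val_eq_exp_neg_one (P : Place K F) : ∃ z : F, P.val z = WithZero.exp (-1 : ℤ) :=
  HeightOneSpectrum.valuation_exists_uniformizer F _

/-- A place is rational as soon as every function regular there is congruent to a constant. -/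
theorem degree_eq_one (P : Place K F)
    (h : ∀ z : F, P.val z ≤ 1 → ∃ c : K, P.val (z - algebraMap K F c) < 1) : P.degree = 1 := by
  refine (finrank_eq_one_iff_of_nonzero' (1 : IsLocalRing.ResidueField P.ring) one_ne_zero).2 ?_
  intro w
  obtain ⟨z, rfl⟩ := IsLocalRing.residue_surjective w
  obtain ⟨c, hc⟩ := h z ((P.mem_ring_iff _).1 z.2)
  refine ⟨c, ?_⟩
  have h1 := (P.val_lt_one_iff (z - algebraMap K P.ring c)).1 hc
  rw [map_sub, sub_eq_zero] at h1
  rw [h1, Algebra.smul_def, mul_one]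
  rfl

variable {R : Type*} [CommRing R] [IsDedekindDomain R] [Algebra K R] [Algebra R F]
  [IsScalarTower K R F] [IsFractionRing R F]

/-- The place of `F` given by a nonzero prime of a Dedekind domain with field of fractions `F`: its
valuation ring is the localization at the prime. -/
noncomputable def ofHeightOneSpectrum (v : HeightOneSpectrum R) : Place K F where
  ring := v.valuationSubringAtPrime F
  algebraMap_mem c := by
    rw [HeightOneSpectrum.valuationSubringAtPrime_eq_valuationSubring,
      Valuation.mem_valuationSubring_iff, IsScalarTower.algebraMap_apply K R F]
    exact v.valuation_le_one _
  isDVR :=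
    haveI : IsLocalization.AtPrime (v.valuationSubringAtPrime F) v.asIdeal :=
      inferInstanceAs (IsLocalization v.asIdeal.primeCompl (v.valuationSubringAtPrime F))
    IsLocalization.AtPrime.isDiscreteValuationRing_of_dedekind_domain R v.ne_bot _

theorem ofHeightOneSpectrum_val_le_one (v : HeightOneSpectrum R) (z : F) :
    (ofHeightOneSpectrum (K := K) v).val z ≤ 1 ↔ v.valuation F z ≤ 1 := by
  rw [← mem_ring_iff]
  change z ∈ v.valuationSubringAtPrime F ↔ _
  rw [HeightOneSpectrum.valuationSubringAtPrime_eq_valuationSubring,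
    Valuation.mem_valuationSubring_iff]

theorem ofHeightOneSpectrum_val_lt_one (v : HeightOneSpectrum R) (z : F) :
    (ofHeightOneSpectrum (K := K) v).val z < 1 ↔ v.valuation F z < 1 := by
  by_cases hz : z = 0
  · simp [hz]
  · have h := ofHeightOneSpectrum_val_le_one (K := K) v z⁻¹
    rw [map_inv₀, map_inv₀, inv_le_one₀ (zero_lt_iff.2 ((Valuation.ne_zero_iff _).2 hz)),
      inv_le_one₀ (zero_lt_iff.2 ((Valuation.ne_zero_iff _).2 hz))] at h
    rw [← not_le, ← not_le, h]

end Place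

/-- If `F = k(y)`, where `k` is the field of fractions of `A` and `y` is a root of a monic polynomial
over `A` whose derivative takes the value `1` at `y`, then `A[y]` is the integral closure of `A` in
`F`. Indeed the derivative of the minimal polynomial of `y` is a unit at `y`, and the ideal which it
generates is contained in the conductor of `A[y]`. -/
theorem integralClosure_le_adjoin {A : Type*} [CommRing A] [IsDedekindDomain A] (k : Type*)
    [Field k] [Algebra A k] [IsFractionRing A k] [Algebra k F] [Algebra A F] [IsScalarTower A k F]
    [FiniteDimensional k F] [Algebra.IsSeparable k F] {y : F} (hy : Algebra.adjoin k {y} = ⊤)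
    (G : Polynomial A) (hG : G.Monic) (h0 : Polynomial.aeval y G = 0)
    (h1 : Polynomial.aeval y G.derivative = 1) {z : F} (hz : IsIntegral A z) :
    z ∈ Algebra.adjoin A {y} := by
  let B := integralClosure A F
  have : IsDedekindDomain B := integralClosure.isDedekindDomain A k F
  have : IsFractionRing B F := integralClosure.isFractionRing_of_finite_extension k F
  have hyi : IsIntegral A y := ⟨G, hG, h0⟩
  let y' : B := ⟨y, hyi⟩
  have hcomp : ∀ p : Polynomial A, algebraMap B F (Polynomial.aeval y' p) = Polynomial.aeval y p :=
    fun p => (Polynomial.aeval_algebraMap_apply F y' p).symm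
  have hinj : Function.Injective (algebraMap B F) := Subtype.val_injective
  have hA : Function.Injective (algebraMap A F) := by
    rw [IsScalarTower.algebraMap_eq A k F]
    exact (algebraMap k F).injective.comp (IsFractionRing.injective A k)
  have : Module.IsTorsionFree A B := by
    have : Function.Injective (algebraMap A B) := by
      intro a b hab
      exact hA (by rw [IsScalarTower.algebraMap_apply A B F, hab,
        ← IsScalarTower.algebraMap_apply A B F])
    exact Module.isTorsionFree_iff_algebraMap_injective.2 this
  have hdvd : minpoly A y' ∣ G := by
    refine minpoly.isIntegrallyClosed_dvd (IsIntegralClosure.isIntegral A F y') (hinj ?_)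
    rw [hcomp, h0, map_zero]
  obtain ⟨Q, hQ⟩ := hdvd
  have hunit : IsUnit (Polynomial.aeval y' (minpoly A y').derivative) := by
    refine IsUnit.of_mul_eq_one (Polynomial.aeval y' Q) (hinj ?_)
    have h2 : Polynomial.aeval y' G.derivative = 1 := hinj (by rw [hcomp, h1, map_one])
    rw [hQ, Polynomial.derivative_mul, map_add, map_mul, map_mul, minpoly.aeval, zero_mul,
      add_zero] at h2
    rw [h2]
  have hcond := conductor_mul_differentIdeal A k F y' hy
  rw [Ideal.span_singleton_eq_top.2 hunit] at hcond
  have htop : conductor A y' = ⊤ := top_le_iff.1 (hcond ▸ Ideal.mul_le_left)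
  have hz' := (conductor_eq_top_iff_adjoin_eq_top.1 htop).ge
    (Algebra.mem_top (x := (⟨z, hz⟩ : B)))
  have h3 : z ∈ (Algebra.adjoin A {y'}).map (IsScalarTower.toAlgHom A B F) :=
    ⟨_, hz', rfl⟩
  rw [AlgHom.map_adjoin_singleton] at h3
  exact h3

end

/-! ### Hermitian pairs of generators -/

section

theorem Place.exists_const_of_mem_adjoin {K F : Type*} [Field K] [Field F] [Algebra K F]
    (P : Place K F) {x y g : F} (hx : P.val x < 1) (hy : P.val y < 1)
    (hg : g ∈ Algebra.adjoin K {x, y}) : ∃ c : K, P.val (g - algebraMap K F c) < 1 := by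
  induction hg using Algebra.adjoin_induction with
  | mem z hz =>
    rcases hz with rfl | rfl
    · exact ⟨0, by simpa using hx⟩
    · exact ⟨0, by simpa using hy⟩
  | algebraMap c => exact ⟨c, by simp⟩
  | add a b _ _ ha hb =>
    obtain ⟨c, hc⟩ := ha
    obtain ⟨d, hd⟩ := hb
    refine ⟨c + d, ?_⟩
    rw [map_add, add_sub_add_comm]
    exact P.val.map_add_lt hc hd
  | mul a b ha' _ ha hb =>
    obtain ⟨c, hc⟩ := ha
    obtain ⟨d, hd⟩ := hb
    refine ⟨c * d, ?_⟩
    have h1 : a * b - algebraMap K F (c * d) =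
        a * (b - algebraMap K F d) + (a - algebraMap K F c) * algebraMap K F d := by
      rw [map_mul]; ring
    rw [h1]
    refine P.val.map_add_lt ?_ ?_ <;> rw [map_mul]
    · rw [mul_comm]
      refine mul_lt_one_of_lt_of_le hd (P.val_le_one_of_mem_adjoin (s := {x, y}) ?_ ha')
      rintro z (rfl | rfl)
      exacts [hx.le, hy.le]
    · exact mul_lt_one_of_lt_of_le hc (P.val_algebraMap_le_one d)

/-- A Hermitian pair: two generators `x`, `y` of a function field `F / K` which satisfy the
Hermitian equation `y^q + y = x^(q+1)`, with `y` transcendental. -/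
structure IsHermitianPair (K : Type*) {F : Type*} [Field K] [Field F] [Algebra K F] (q : ℕ)
    (x y : F) : Prop where
  equation : y ^ q + y = x ^ (q + 1)
  adjoin_eq_top : IntermediateField.adjoin K {x, y} = ⊤
  transcendental : Transcendental K y

variable {K F : Type*} [Field K] [Field F] [Algebra K F] {q : ℕ} {x y : F}

theorem natCast_eq_zero_of_card [hq : Fact (IsPrimePow q)] [hK : Fact (Nat.card K = q ^ 2)]
    (R : Type*) [Ring R] [Algebra K R] : (q : R) = 0 := by
  have h : (q : K) ^ 2 = 0 := by
    have : Finite K := Nat.finite_of_card_ne_zero (by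
      rw [hK.out]; exact pow_ne_zero _ hq.out.ne_zero)
    have := Fintype.ofFinite K
    rw [← Nat.cast_pow, ← hK.out, Nat.card_eq_fintype_card]
    exact FiniteField.cast_card_eq_zero K
  rw [← map_natCast (algebraMap K R), pow_eq_zero_iff two_ne_zero |>.1 h, map_zero]

theorem isDedekindDomain_adjoin_singleton {x : F} (hx : Transcendental K x) :
    IsDedekindDomain (Algebra.adjoin K {x}) := by
  let e := Polynomial.algEquivOfTranscendental K x hx
  have : IsPrincipalIdealRing (Algebra.adjoin K {x}) :=
    IsPrincipalIdealRing.of_surjective e.toRingEquiv e.surjective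
  infer_instance

namespace IsHermitianPair

theorem transcendental_fst (h : IsHermitianPair K q x y) (hq : 2 ≤ q) : Transcendental K x := by
  have h1 : Polynomial.natDegree (Polynomial.X ^ q + Polynomial.X : Polynomial K) = q := by
    compute_degree!
    · rw [if_neg (by omega)]; simp
    · omega
  have h2 := h.transcendental.aeval (Polynomial.X ^ q + Polynomial.X)
    (by rw [h1]; omega)
    (mem_nonZeroDivisors_of_ne_zero (by
      rw [Polynomial.leadingCoeff_ne_zero]; intro h0; rw [h0] at h1; simp at h1; omega))
  rw [map_add, map_pow, Polynomial.aeval_X, h.equation] at h2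
  exact fun h3 => h2 (h3.pow _)

theorem fst_ne_zero (h : IsHermitianPair K q x y) (hq : 2 ≤ q) : x ≠ 0 := fun h0 =>
  h.transcendental_fst hq (h0 ▸ isAlgebraic_zero)

theorem snd_ne_zero (h : IsHermitianPair K q x y) : y ≠ 0 := fun h0 =>
  h.transcendental (h0 ▸ isAlgebraic_zero)

theorem isFractionRing (h : IsHermitianPair K q x y) :
    IsFractionRing (Algebra.adjoin K {x, y}) F :=
  .of_field _ _ fun z =>
    have ⟨a, ha, b, hb, e⟩ := IntermediateField.mem_adjoin_iff_div.1
      (h.adjoin_eq_top ▸ IntermediateField.mem_top : z ∈ IntermediateField.adjoin K {x, y})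
    ⟨⟨a, ha⟩, ⟨b, hb⟩, e⟩

theorem val_one_add_pow (hq2 : 2 ≤ q) (P : Place K F) (hy : P.val y < 1) :
    P.val (1 + y ^ (q - 1)) = 1 := by
  have h1 : P.val (y ^ (q - 1)) < P.val 1 := by
    rw [map_pow, map_one]; exact pow_lt_one₀ zero_le hy (by omega)
  rw [Valuation.map_add_eq_of_lt_left _ h1, map_one]

theorem mul_one_add_pow (h : IsHermitianPair K q x y) (hq2 : 2 ≤ q) :
    y * (1 + y ^ (q - 1)) = x * x ^ q := by
  rw [← pow_succ', ← h.equation, mul_add, mul_one, ← pow_succ', Nat.sub_add_cancel (by omega),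
    add_comm]

theorem place_unique (h : IsHermitianPair K q x y) (hq2 : 2 ≤ q) {P Q : Place K F}
    (hPx : P.val x < 1) (hPy : P.val y < 1) (hQx : Q.val x < 1) (hQy : Q.val y < 1) : P = Q :=
  Place.eq_of_center h.adjoin_eq_top
    (add_mem (one_mem _) (pow_mem (Algebra.subset_adjoin (by simp)) _))
    (pow_mem (Algebra.subset_adjoin (by simp)) q) (h.mul_one_add_pow hq2) P Q
    hPx hPy (val_one_add_pow hq2 P hPy) hQx hQy (val_one_add_pow hq2 Q hQy)

/-- The first coordinate of a Hermitian pair is a uniformizer at the center. -/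
theorem val_fst (h : IsHermitianPair K q x y) (hq2 : 2 ≤ q) {P : Place K F}
    (hPx : P.val x < 1) (hPy : P.val y < 1) : P.val x = WithZero.exp (-1 : ℤ) := by
  have hpow : ∀ g ∈ Algebra.adjoin K {x, y}, g ≠ 0 → ∃ k : ℕ, P.val g = P.val x ^ k := by
    intro g hg hg0
    have hv : P.val g ≠ 0 := (Valuation.ne_zero_iff _).2 hg0
    obtain ⟨k, w, hw, -, rfl⟩ := Place.exists_decomp
      (add_mem (one_mem _) (pow_mem (Algebra.subset_adjoin (by simp)) _))
      (pow_mem (Algebra.subset_adjoin (by simp)) q) (h.mul_one_add_pow hq2) P P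
      hPx hPy (val_one_add_pow hq2 P hPy) hPx hPy (val_one_add_pow hq2 P hPy)
      (WithZero.log (P.val g)).natAbs g hg hg0 (by
        rw [← WithZero.exp_log hv, WithZero.exp_le_exp, WithZero.log_exp]
        omega)
    exact ⟨k, by rw [map_mul, hw, mul_one, map_pow]⟩
  -- the valuation of every function is a power of that of `x`, and some function has order `1`
  obtain ⟨z, hz⟩ := P.exists_val_eq_exp_neg_one
  have hz0 : z ≠ 0 := by
    rintro rfl
    rw [map_zero] at hz
    exact WithZero.exp_ne_zero hz.symm
  obtain ⟨a, ha, b, hb, rfl⟩ := IntermediateField.mem_adjoin_iff_div.1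
    (h.adjoin_eq_top ▸ IntermediateField.mem_top : z ∈ IntermediateField.adjoin K {x, y})
  obtain ⟨k, hk⟩ := hpow a ha fun h0 => hz0 (by simp [h0])
  obtain ⟨l, hl⟩ := hpow b hb fun h0 => hz0 (by simp [h0])
  have hx0 : P.val x ≠ 0 := (Valuation.ne_zero_iff _).2 (h.fst_ne_zero hq2)
  rw [map_div₀, hk, hl] at hz
  rw [← WithZero.exp_log hx0] at hz hPx ⊢
  generalize WithZero.log (P.val x) = n at *
  rw [← WithZero.exp_nsmul, ← WithZero.exp_nsmul, ← WithZero.exp_sub, WithZero.exp_inj] at hz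
  rw [← WithZero.exp_zero, WithZero.exp_lt_exp] at hPx
  rw [WithZero.exp_inj]
  have h1 : n * ((l : ℤ) - k) = 1 := by
    simp only [nsmul_eq_mul] at hz; linear_combination -hz
  rcases Int.eq_one_or_neg_one_of_mul_eq_one h1 with h2 | h2 <;> omega

theorem val_snd (h : IsHermitianPair K q x y) (hq2 : 2 ≤ q) {P : Place K F}
    (hPx : P.val x < 1) (hPy : P.val y < 1) :
    P.val y = WithZero.exp (-((q : ℤ) + 1)) := by
  have h1 := congrArg P.val (h.mul_one_add_pow hq2)
  rw [map_mul, val_one_add_pow hq2 P hPy, mul_one, ← pow_succ', map_pow, h.val_fst hq2 hPx hPy,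
    ← WithZero.exp_nsmul] at h1
  rw [h1, WithZero.exp_inj]
  simp

variable [hq : Fact (IsPrimePow q)] [hK : Fact (Nat.card K = q ^ 2)]

open scoped IntermediateField.algebraAdjoinAdjoin in
open Polynomial in
/-- The affine Hermitian curve is smooth: `T^q + T - x^(q+1)` has derivative `1` in characteristic
`p ∣ q`, so that `K[x, y]` is the integral closure of `K[x]` in `F`. -/
theorem isDedekindDomain (h : IsHermitianPair K q x y) :
    IsDedekindDomain (Algebra.adjoin K {x, y}) := by
  have hq2 : 2 ≤ q := hq.out.two_le
  set A := Algebra.adjoin K {x}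
  set k := IntermediateField.adjoin K {x}
  have hA : IsDedekindDomain A := isDedekindDomain_adjoin_singleton (h.transcendental_fst hq2)
  let x' : A := ⟨x, Algebra.self_mem_adjoin_singleton K x⟩
  let G : A[X] := X ^ q + (X - C (x' ^ (q + 1)))
  have hG : G.Monic := by
    refine monic_X_pow_add ((degree_sub_le _ _).trans_lt ?_)
    refine max_lt (degree_X_le.trans_lt (by exact_mod_cast hq2)) (degree_C_le.trans_lt ?_)
    exact_mod_cast (by omega : 0 < q)
  have h0 : aeval y G = 0 := by
    have : algebraMap A F x' = x := rfl
    simp only [G, map_add, map_sub, map_pow, aeval_X, aeval_C, this]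
    rw [← h.equation]; ring
  have h1 : G.derivative = 1 := by
    have : (q : A) = 0 := natCast_eq_zero_of_card (K := K) A
    simp only [G, derivative_add, derivative_sub, derivative_X_pow, derivative_X, derivative_C, this]
    simp
  have hyi : IsIntegral A y := ⟨G, hG, h0⟩
  have hyk : IsIntegral k y := hyi.tower_top
  have hgen : IntermediateField.adjoin k {y} = ⊤ := by
    rw [← IntermediateField.restrictScalars_eq_top_iff (K := K),
      IntermediateField.adjoin_adjoin_left, Set.singleton_union, h.adjoin_eq_top]
  have hgen' : Algebra.adjoin k {y} = ⊤ := by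
    rw [← IntermediateField.adjoin_simple_toSubalgebra_of_isAlgebraic hyk.isAlgebraic, hgen,
      IntermediateField.top_toSubalgebra]
  have : FiniteDimensional k F := by
    have := IntermediateField.adjoin.finiteDimensional hyk
    rw [hgen] at this
    exact Module.Finite.equiv (IntermediateField.topEquiv (F := k) (E := F)).toLinearEquiv
  have : Algebra.IsSeparable k F := by
    have hs : IsSeparable k y := by
      have : (G.map (algebraMap A k)).Separable := by
        refine (Polynomial.separable_def _).2 ⟨0, 1, ?_⟩
        rw [derivative_map, h1]; simp
      refine this.of_dvd (minpoly.dvd _ _ ?_)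
      rw [aeval_map_algebraMap, h0]
    have := (IntermediateField.isSeparable_adjoin_simple_iff_isSeparable _ _).2 hs
    rw [hgen] at this
    exact Algebra.IsSeparable.of_algHom k (⊤ : IntermediateField k F)
      (IntermediateField.topEquiv (F := k) (E := F)).symm.toAlgHom
  have heq : (integralClosure A F).restrictScalars K = Algebra.adjoin K {x, y} := by
    rw [← Set.singleton_union, Algebra.adjoin_union_eq_adjoin_adjoin]
    refine le_antisymm (fun z hz => ?_) (fun z hz => ?_)
    · exact integralClosure_le_adjoin k hgen' G hG h0 (by rw [h1, map_one]) hz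
    · exact Algebra.adjoin_le (S := integralClosure A F) (Set.singleton_subset_iff.2 hyi) hz
  rw [← heq]
  exact integralClosure.isDedekindDomain A k F

/-- A function regular at all places in the affine part is a polynomial in `x` and `y`. -/
theorem mem_adjoin_of_forall_val_le_one (h : IsHermitianPair K q x y) {z : F}
    (hz : ∀ P : Place K F, P.val x ≤ 1 → P.val y ≤ 1 → P.val z ≤ 1) :
    z ∈ Algebra.adjoin K {x, y} := by
  have := h.isDedekindDomain
  have := h.isFractionRing
  obtain ⟨w, rfl⟩ := HeightOneSpectrum.mem_integers_of_valuation_le_one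
    (R := Algebra.adjoin K {x, y}) F z fun v => by
      rw [← Place.ofHeightOneSpectrum_val_le_one (K := K)]
      refine hz _ ?_ ?_ <;> rw [Place.ofHeightOneSpectrum_val_le_one]
      · exact v.valuation_le_one (⟨x, Algebra.subset_adjoin (by simp)⟩ : Algebra.adjoin K {x, y})
      · exact v.valuation_le_one (⟨y, Algebra.subset_adjoin (by simp)⟩ : Algebra.adjoin K {x, y})
  exact w.2

/-- The center `(0, 0)` of a Hermitian pair is the center of some place: `y` is not a unit of the
coordinate ring, which is integral over `K[y]`. -/
theorem exists_place (h : IsHermitianPair K q x y) :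
    ∃ P : Place K F, P.degree = 1 ∧ P.val x < 1 ∧ P.val y < 1 := by
  have hq2 : 2 ≤ q := hq.out.two_le
  have := h.isDedekindDomain
  have := h.isFractionRing
  set R := Algebra.adjoin K {x, y} with hR
  let x' : R := ⟨x, Algebra.subset_adjoin (by simp)⟩
  let y' : R := ⟨y, Algebra.subset_adjoin (by simp)⟩
  have hy0 : y' ≠ 0 := fun h0 => h.snd_ne_zero (congrArg Subtype.val h0)
  have hxy : x' ^ (q + 1) = y' ^ q + y' := Subtype.ext h.equation.symm
  have hunit : ¬ IsUnit y' := by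
    intro hu
    have hyR : Transcendental K y' := fun h0 => h.transcendental (h0.algHom R.val)
    -- `y` is already a unit in `K[y]`, over which the coordinate ring is integral
    let B := Algebra.adjoin K {y'}
    have hint : Algebra.IsIntegral B R := by
      have hx : IsIntegral B x' := by
        refine IsIntegral.of_pow (Nat.succ_pos q) ?_
        rw [hxy]
        have : IsIntegral B y' := isIntegral_algebraMap
          (x := (⟨y', Algebra.self_mem_adjoin_singleton K y'⟩ : B))
        exact (this.pow q).add this
      have hy : IsIntegral B y' := isIntegral_algebraMap
          (x := (⟨y', Algebra.self_mem_adjoin_singleton K y'⟩ : B))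
      refine ⟨fun r => ?_⟩
      obtain ⟨r, hr⟩ := r
      induction hr using Algebra.adjoin_induction with
      | mem z hz =>
        rcases hz with rfl | rfl
        · exact hx
        · exact hy
      | algebraMap c => exact isIntegral_algebraMap (x := algebraMap K B c)
      | add a b ha hb iha ihb => exact iha.add ihb
      | mul a b ha hb iha ihb => exact iha.mul ihb
    have hu' : IsUnit (⟨y', Algebra.self_mem_adjoin_singleton K y'⟩ : B) :=
      have := (algebraMap_isIntegral_iff.2 hint).isLocalHom
        (f := algebraMap B R) Subtype.val_injective
      isUnit_of_map_unit (algebraMap B R) _ hu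
    let e := Polynomial.algEquivOfTranscendental K y' hyR
    have he : e.symm ⟨y', Algebra.self_mem_adjoin_singleton K y'⟩ = Polynomial.X := by
      rw [AlgEquiv.symm_apply_eq]
      exact Subtype.ext (by simp [e])
    have hX := hu'.map e.symm
    rw [he] at hX
    exact Polynomial.not_isUnit_X hX
  obtain ⟨M, hM, hyM⟩ := exists_max_ideal_of_mem_nonunits hunit
  let v : HeightOneSpectrum R := ⟨M, hM.isPrime, fun h0 => hy0 (by simpa [h0] using hyM)⟩
  have hxM : x' ∈ M := by
    refine hM.isPrime.mem_of_pow_mem (q + 1) ?_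
    rw [hxy]
    exact add_mem (Ideal.pow_mem_of_mem _ hyM _ (by omega)) hyM
  let P : Place K F := Place.ofHeightOneSpectrum v
  have hPx : P.val x < 1 :=
    (Place.ofHeightOneSpectrum_val_lt_one v x).2 ((v.valuation_lt_one_iff_mem x').2 hxM)
  have hPy : P.val y < 1 :=
    (Place.ofHeightOneSpectrum_val_lt_one v y).2 ((v.valuation_lt_one_iff_mem y').2 hyM)
  refine ⟨P, P.degree_eq_one fun z hz => ?_, hPx, hPy⟩
  obtain ⟨a, ha⟩ := v.exists_valuation_sub_lt_of_integer
    ((Place.ofHeightOneSpectrum_val_le_one v z).1 hz) 1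
  have ha' : P.val ((a : F) - z) < 1 := (Place.ofHeightOneSpectrum_val_lt_one v _).2 ha
  obtain ⟨c, hc⟩ := P.exists_const_of_mem_adjoin hPx hPy a.2
  refine ⟨c, ?_⟩
  have := P.val.map_sub_lt hc ha'
  rwa [sub_sub_sub_cancel_left] at this

end IsHermitianPair

end

/-! ### Changes of coordinates and the place at infinity -/

section

variable {K F : Type*} [Field K] [Field F] [Algebra K F] {q : ℕ} {x y : F}

theorem Place.eq_zero_of_val_algebraMap_lt_one (P : Place K F) {c : K}
    (h : P.val (algebraMap K F c) < 1) : c = 0 := by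
  by_contra hc
  exact h.ne (P.val_algebraMap hc)

theorem pow_card_sq [hq : Fact (IsPrimePow q)] [hK : Fact (Nat.card K = q ^ 2)] (c : K) :
    (c ^ q) ^ q = c := by
  have : Finite K := Nat.finite_of_card_ne_zero (by
    rw [hK.out]; exact pow_ne_zero _ hq.out.ne_zero)
  have := Fintype.ofFinite K
  rw [← pow_mul, ← sq, ← hK.out, Nat.card_eq_fintype_card, FiniteField.pow_card]

theorem frobenius_sub [hq : Fact (IsPrimePow q)] [hK : Fact (Nat.card K = q ^ 2)] (a b : F) :
    (a - b) ^ q = a ^ q - b ^ q := by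
  rw [eq_sub_iff_add_eq, ← HermitianFunctionField.frobenius_add K q F, sub_add_cancel]

namespace IsHermitianPair

theorem inv (h : IsHermitianPair K q x y) : IsHermitianPair K q (x * y⁻¹) y⁻¹ where
  equation := by
    have hy := h.snd_ne_zero
    have := h.equation
    rw [mul_pow, ← this, inv_pow, inv_pow, pow_succ]
    field_simp
    exact add_comm _ _
  adjoin_eq_top := by
    have hy : y ∈ IntermediateField.adjoin K {x * y⁻¹, y⁻¹} := by
      rw [← inv_inv y]
      exact inv_mem (IntermediateField.subset_adjoin _ _ (by simp))
    refine top_le_iff.1 (h.adjoin_eq_top ▸ IntermediateField.adjoin_le_iff.2 ?_)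
    rintro z (rfl | rfl)
    · have h1 : z * y⁻¹ ∈ IntermediateField.adjoin K {z * y⁻¹, y⁻¹} :=
        IntermediateField.subset_adjoin _ _ (by simp)
      have h2 := mul_mem h1 hy
      rwa [inv_mul_cancel_right₀ h.snd_ne_zero] at h2
    · exact hy
  transcendental h0 := h.transcendental (by simpa using h0.inv)

theorem val_fst_lt_one (h : IsHermitianPair K q x y) (hq2 : 2 ≤ q) (P : Place K F)
    (hy : P.val y < 1) : P.val x < 1 := by
  have h1 : P.val x ^ (q + 1) < 1 := by
    rw [← map_pow, ← h.equation]
    refine P.val.map_add_lt ?_ hy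
    rw [map_pow]; exact pow_lt_one₀ zero_le hy (by omega)
  exact (pow_lt_one_iff_of_nonneg zero_le (Nat.succ_ne_zero q)).1 h1

theorem val_fst_le_one (h : IsHermitianPair K q x y) (P : Place K F)
    (hy : P.val y ≤ 1) : P.val x ≤ 1 := by
  have h1 : P.val x ^ (q + 1) ≤ 1 := by
    rw [← map_pow, ← h.equation]
    rw [← Place.mem_ring_iff] at hy ⊢
    exact add_mem (pow_mem hy q) hy
  exact (pow_le_one_iff_of_nonneg zero_le (Nat.succ_ne_zero q)).1 h1

theorem val_inv_lt_one {P : Place K F} (hP : 1 < P.val y) : P.val y⁻¹ < 1 := by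
  rw [map_inv₀]; exact inv_lt_one_of_one_lt₀ hP

/-- There is at most one place at infinity. -/
theorem place_infinity_unique (h : IsHermitianPair K q x y) (hq2 : 2 ≤ q) {P Q : Place K F}
    (hP : 1 < P.val y) (hQ : 1 < Q.val y) : P = Q :=
  h.inv.place_unique hq2 (h.inv.val_fst_lt_one hq2 P (val_inv_lt_one hP)) (val_inv_lt_one hP)
    (h.inv.val_fst_lt_one hq2 Q (val_inv_lt_one hQ)) (val_inv_lt_one hQ)

theorem val_snd_infinity (h : IsHermitianPair K q x y) (hq2 : 2 ≤ q) {P : Place K F}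
    (hP : 1 < P.val y) : P.val y = WithZero.exp ((q : ℤ) + 1) := by
  have h1 := h.inv.val_snd hq2 (h.inv.val_fst_lt_one hq2 P (val_inv_lt_one hP)) (val_inv_lt_one hP)
  rw [map_inv₀, WithZero.exp_neg, inv_inj] at h1
  exact h1

theorem val_fst_infinity (h : IsHermitianPair K q x y) (hq2 : 2 ≤ q) {P : Place K F}
    (hP : 1 < P.val y) : P.val x = WithZero.exp (q : ℤ) := by
  have h1 := h.inv.val_fst hq2 (h.inv.val_fst_lt_one hq2 P (val_inv_lt_one hP)) (val_inv_lt_one hP)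
  rw [← inv_mul_cancel_right₀ h.snd_ne_zero x, map_mul, h1, h.val_snd_infinity hq2 hP,
    ← WithZero.exp_add]
  congr 1; ring

theorem val_snd_le_one (h : IsHermitianPair K q x y) (hq2 : 2 ≤ q) (P : Place K F)
    (hx : P.val x ≤ 1) : P.val y ≤ 1 := by
  by_contra hy
  rw [h.val_fst_infinity hq2 (not_le.1 hy), ← WithZero.exp_zero, WithZero.exp_le_exp] at hx
  omega

theorem val_tangent_lt_one_iff {a b : K} (hab : b ^ q + b = a ^ (q + 1)) {P : Place K F}
    (ha : P.val (x - algebraMap K F a) < 1) :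
    P.val (y + algebraMap K F (b ^ q) - algebraMap K F (a ^ q) * x) < 1 ↔
      P.val (y - algebraMap K F b) < 1 := by
  have h1 : P.val (algebraMap K F (a ^ q) * (x - algebraMap K F a)) < 1 := by
    rw [mul_comm, map_mul]
    exact mul_lt_one_of_lt_of_le ha (P.val_algebraMap_le_one _)
  have h2 : y + algebraMap K F (b ^ q) - algebraMap K F (a ^ q) * x =
      y - algebraMap K F b - algebraMap K F (a ^ q) * (x - algebraMap K F a) := by
    have h3 := congrArg (algebraMap K F) hab
    rw [map_add, pow_succ, map_mul] at h3
    linear_combination h3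
  rw [h2]
  refine ⟨fun h => ?_, fun h => P.val.map_sub_lt h h1⟩
  simpa using P.val.map_add_lt h h1

variable [hq : Fact (IsPrimePow q)] [hK : Fact (Nat.card K = q ^ 2)]

theorem exists_place_infinity (h : IsHermitianPair K q x y) :
    ∃ P : Place K F, P.degree = 1 ∧ 1 < P.val y := by
  obtain ⟨P, hP, -, hy⟩ := h.inv.exists_place
  refine ⟨P, hP, ?_⟩
  rw [map_inv₀] at hy
  exact (inv_lt_one_iff₀.1 hy).resolve_left
    (not_le.2 (zero_lt_iff.2 ((Valuation.ne_zero_iff _).2 h.snd_ne_zero)))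

/-- A rational point `(a, b)` of the affine Hermitian curve can be moved to the origin; the second
coordinate is the equation of the tangent line at `(a, b)`, which meets the curve only there. -/
theorem translate (h : IsHermitianPair K q x y) {a b : K} (hab : b ^ q + b = a ^ (q + 1)) :
    IsHermitianPair K q (x - algebraMap K F a)
      (y + algebraMap K F (b ^ q) - algebraMap K F (a ^ q) * x) := by
  have heq : (y + algebraMap K F (b ^ q) - algebraMap K F (a ^ q) * x) ^ q +
      (y + algebraMap K F (b ^ q) - algebraMap K F (a ^ q) * x) =
      (x - algebraMap K F a) ^ (q + 1) := by
    rw [pow_succ, frobenius_sub (K := K), frobenius_sub (K := K),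
      HermitianFunctionField.frobenius_add K q F, mul_pow, ← map_pow, ← map_pow (algebraMap K F),
      pow_card_sq, pow_card_sq, ← map_pow]
    have h1 := congrArg (algebraMap K F) hab
    rw [map_add, pow_succ, map_mul] at h1
    have h2 := h.equation
    rw [pow_succ] at h2
    linear_combination h1 + h2
  have htop : IntermediateField.adjoin K {x - algebraMap K F a,
      y + algebraMap K F (b ^ q) - algebraMap K F (a ^ q) * x} = ⊤ := by
    set L := IntermediateField.adjoin K {x - algebraMap K F a,
      y + algebraMap K F (b ^ q) - algebraMap K F (a ^ q) * x} with hL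
    have hx : x ∈ L := by
      have h1 : x - algebraMap K F a ∈ L := IntermediateField.subset_adjoin _ _ (by simp)
      simpa using add_mem h1 (L.algebraMap_mem a)
    have hy : y ∈ L := by
      have h1 : y + algebraMap K F (b ^ q) - algebraMap K F (a ^ q) * x ∈ L :=
        IntermediateField.subset_adjoin _ _ (by simp)
      have h2 := sub_mem (add_mem h1 (mul_mem (L.algebraMap_mem (a ^ q)) hx))
        (L.algebraMap_mem (b ^ q))
      simpa using h2
    refine top_le_iff.1 (h.adjoin_eq_top ▸ IntermediateField.adjoin_le_iff.2 ?_)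
    rintro z (rfl | rfl)
    exacts [hx, hy]
  refine ⟨heq, htop, fun h0 => ?_⟩
  have h1 : IsAlgebraic K (x - algebraMap K F a) := by
    refine IsAlgebraic.of_pow (Nat.succ_pos q) ?_
    rw [← heq]
    exact (h0.pow q).add h0
  refine h.transcendental_fst hq.out.two_le ?_
  simpa using h1.add (isAlgebraic_algebraMap a)

/-- A rational place of the affine part is centered at a rational point of the affine curve. -/
theorem exists_center (h : IsHermitianPair K q x y) {P : Place K F} (hP : P.degree = 1)
    (hy : P.val y ≤ 1) : ∃ a b : K, b ^ q + b = a ^ (q + 1) ∧ P.val (x - algebraMap K F a) < 1 ∧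
      P.val (y - algebraMap K F b) < 1 := by
  have hq2 : 2 ≤ q := hq.out.two_le
  have hx := h.val_fst_le_one P hy
  obtain ⟨a, ha⟩ := P.exists_const hP x hx
  obtain ⟨b, hb⟩ := P.exists_const hP y hy
  refine ⟨a, b, ?_, ha, hb⟩
  rw [← sub_eq_zero]
  refine P.eq_zero_of_val_algebraMap_lt_one ?_
  have h1 : algebraMap K F (b ^ q + b - a ^ (q + 1)) =
      (x ^ q * (x - algebraMap K F a) + algebraMap K F a * (x - algebraMap K F a) ^ q) -
      ((y - algebraMap K F b) ^ q + (y - algebraMap K F b)) := by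
    rw [frobenius_sub (K := K), frobenius_sub (K := K), map_sub, map_add, pow_succ, map_mul,
      map_pow, map_pow]
    have h2 := h.equation
    rw [pow_succ] at h2
    linear_combination h2
  have hq0 : q ≠ 0 := by omega
  rw [h1]
  refine P.val.map_sub_lt (P.val.map_add_lt ?_ ?_) (P.val.map_add_lt ?_ hb)
  · rw [mul_comm, map_mul, map_pow]
    exact mul_lt_one_of_lt_of_le ha (pow_le_one₀ zero_le hx)
  · rw [mul_comm, map_mul, map_pow]
    exact mul_lt_one_of_lt_of_le (pow_lt_one₀ zero_le ha hq0) (P.val_algebraMap_le_one a)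
  · rw [map_pow]; exact pow_lt_one₀ zero_le hb hq0

/-- The tangent line at a rational point `P` of the affine curve has divisor `(q + 1) (P - ∞)`. -/
theorem exists_divisor (h : IsHermitianPair K q x y) {I : Place K F} (hI : 1 < I.val y)
    (P : Place K F) (hP : P.degree = 1) : ∃ u : Additive Fˣ, ∀ Q : Place K F,
      Q.ord u = ((q : ℤ) + 1) * (Set.indicator {P} 1 Q - Set.indicator {I} 1 Q) := by
  have hq2 : 2 ≤ q := hq.out.two_le
  by_cases hPy : P.val y ≤ 1
  · obtain ⟨a, b, hab, ha, hb⟩ := h.exists_center hP hPy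
    have ht := h.translate hab
    have hw := (val_tangent_lt_one_iff hab ha).2 hb
    set w := y + algebraMap K F (b ^ q) - algebraMap K F (a ^ q) * x with hwdef
    have hPI : P ≠ I := by rintro rfl; exact not_lt.2 hPy hI
    let u : Additive Fˣ := Additive.ofMul (Units.mk0 w ht.snd_ne_zero)
    have key : ∀ (Q : Place K F) (n : ℤ), Q.val w = WithZero.exp (-n) → Q.ord u = n := by
      intro Q n hn
      have h1 := Q.val_toMul u
      change Q.val w = _ at h1
      rw [hn, WithZero.exp_inj] at h1
      omega
    refine ⟨u, fun Q => key Q _ ?_⟩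
    by_cases hQP : Q = P
    · subst hQP
      simp [hPI, ht.val_snd hq2 ha hw]
    by_cases hQI : Q = I
    · subst hQI
      have h1 : Q.val (algebraMap K F (b ^ q) - algebraMap K F (a ^ q) * x) < Q.val y := by
        rw [h.val_snd_infinity hq2 hI]
        refine Q.val.map_sub_lt ((Q.val_algebraMap_le_one _).trans_lt ?_) ?_
        · rw [← WithZero.exp_zero, WithZero.exp_lt_exp]; omega
        · rw [map_mul, h.val_fst_infinity hq2 hI]
          refine (mul_le_of_le_one_left zero_le (Q.val_algebraMap_le_one _)).trans_lt ?_
          rw [WithZero.exp_lt_exp]; omega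
      rw [hwdef, add_sub_assoc, Valuation.map_add_eq_of_lt_left _ h1, h.val_snd_infinity hq2 hI]
      simp [hQP]
    · have hQy : Q.val y ≤ 1 := by
        by_contra hQy
        exact hQI (h.place_infinity_unique hq2 (not_le.1 hQy) hI)
      have hQx := h.val_fst_le_one Q hQy
      have h1 : Q.val w ≤ 1 := by
        have h2 : algebraMap K F (a ^ q) * x ∈ Q.ring :=
          mul_mem (Q.algebraMap_mem _) ((Q.mem_ring_iff _).2 hQx)
        exact (Q.mem_ring_iff _).1
          (sub_mem (add_mem ((Q.mem_ring_iff _).2 hQy) (Q.algebraMap_mem _)) h2)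
      have h2 : ¬ Q.val w < 1 := fun hlt =>
        hQP (ht.place_unique hq2 (ht.val_fst_lt_one hq2 Q hlt) hlt ha hw)
      simp [hQP, hQI, le_antisymm h1 (not_lt.1 h2)]
  · have hPI : P = I := h.place_infinity_unique hq2 (not_le.1 hPy) hI
    exact ⟨0, fun Q => by simp [hPI]⟩

end IsHermitianPair

end

/-! ### Functions with poles only at infinity -/

open Polynomial

section

variable {K F : Type*} [Field K] [Field F] [Algebra K F] {q : ℕ} {x y : F}

namespace IsHermitianPair

theorem exists_eq_sum_of_mem_adjoin (h : IsHermitianPair K q x y) {z : F}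
    (hz : z ∈ Algebra.adjoin K {x, y}) :
    ∃ p : ℕ → K[X], z = ∑ i ∈ Finset.range (q + 1), aeval y (p i) * x ^ i := by
  set φ : K[X][X] →+* F := eval₂RingHom (aeval y : K[X] →ₐ[K] F).toRingHom x with hφ
  have hz' : ∃ P : K[X][X], φ P = z := by
    induction hz using Algebra.adjoin_induction with
    | mem w hw =>
      rcases hw with rfl | rfl
      · exact ⟨X, by simp [hφ]⟩
      · exact ⟨C X, by simp [hφ]⟩
    | algebraMap c => exact ⟨C (C c), by simp [hφ]⟩
    | add a b _ _ ha hb =>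
      obtain ⟨P, rfl⟩ := ha
      obtain ⟨Q, rfl⟩ := hb
      exact ⟨P + Q, map_add _ _ _⟩
    | mul a b _ _ ha hb =>
      obtain ⟨P, rfl⟩ := ha
      obtain ⟨Q, rfl⟩ := hb
      exact ⟨P * Q, map_mul _ _ _⟩
  obtain ⟨P, rfl⟩ := hz'
  set f : K[X][X] := X ^ (q + 1) - C (X ^ q + X) with hf
  have hmonic : f.Monic := monic_X_pow_sub_C _ (Nat.succ_ne_zero q)
  have hdeg : f.natDegree = q + 1 := natDegree_X_pow_sub_C
  have hφf : φ f = 0 := by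
    simp only [hφ, hf, coe_eval₂RingHom, eval₂_sub, eval₂_pow, eval₂_X, eval₂_C]
    rw [← h.equation]
    simp
  refine ⟨fun i => (P %ₘ f).coeff i, ?_⟩
  have h1 : (P %ₘ f).natDegree < q + 1 := by
    rw [← hdeg]
    exact natDegree_modByMonic_lt P hmonic fun h1 => by rw [h1] at hdeg; simp at hdeg
  calc φ P = φ (P %ₘ f + f * (P /ₘ f)) := by rw [modByMonic_add_div]
    _ = φ (P %ₘ f) := by rw [map_add, map_mul, hφf, zero_mul, add_zero]
    _ = _ := eval₂_eq_sum_range' _ h1 x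

/-- At infinity, `p(y)` has a pole of order `(q + 1) deg p`. -/
theorem val_aeval_infinity (h : IsHermitianPair K q x y) (hq2 : 2 ≤ q) {I : Place K F}
    (hI : 1 < I.val y) {p : K[X]} (hp : p ≠ 0) :
    I.val (aeval y p) = WithZero.exp ((p.natDegree * (q + 1) : ℕ) : ℤ) := by
  have hpow : ∀ n : ℕ, I.val (y ^ n) = WithZero.exp ((n * (q + 1) : ℕ) : ℤ) := fun n => by
    rw [map_pow, h.val_snd_infinity hq2 hI, ← WithZero.exp_nsmul]
    simp
  have htop : I.val (p.coeff p.natDegree • y ^ p.natDegree) =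
      WithZero.exp ((p.natDegree * (q + 1) : ℕ) : ℤ) := by
    rw [Algebra.smul_def, map_mul, I.val_algebraMap (by simpa using hp), one_mul, hpow]
  rw [aeval_eq_sum_range, Valuation.map_sum_eq_of_lt I.val (j := p.natDegree)
    (Finset.self_mem_range_succ _), htop]
  intro i hi
  rw [Finset.mem_sdiff, Finset.mem_range, Finset.mem_singleton] at hi
  rw [htop, Algebra.smul_def, map_mul]
  refine (mul_le_of_le_one_left zero_le (I.val_algebraMap_le_one _)).trans_lt ?_
  rw [hpow, WithZero.exp_lt_exp, Nat.cast_lt]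
  exact Nat.mul_lt_mul_of_pos_right (by omega) (Nat.succ_pos q)

/-- A polynomial in `x` and `y` without a pole at infinity is constant: the monomials `x^i y^j` with
`i ≤ q`, which span the coordinate ring, have distinct pole orders `q i + (q + 1) j`. -/
theorem eq_const_of_mem_adjoin (h : IsHermitianPair K q x y) (hq2 : 2 ≤ q) {I : Place K F}
    (hI : 1 < I.val y) {z : F} (hz : z ∈ Algebra.adjoin K {x, y}) (hzI : I.val z ≤ 1) :
    ∃ c : K, z = algebraMap K F c := by
  classical
  obtain ⟨p, hp⟩ := h.exists_eq_sum_of_mem_adjoin hz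
  set n : ℕ → ℕ := fun i => (p i).natDegree * (q + 1) + i * q with hn
  have hval : ∀ i, p i ≠ 0 → I.val (aeval y (p i) * x ^ i) = WithZero.exp (n i : ℤ) := by
    intro i hi
    rw [map_mul, map_pow, h.val_aeval_infinity hq2 hI hi, h.val_fst_infinity hq2 hI,
      ← WithZero.exp_nsmul, ← WithZero.exp_add, WithZero.exp_inj]
    simp [hn]
  have hinj : ∀ i j, i < q + 1 → j < q + 1 → n i = n j → i = j := by
    intro i j hi hj hij
    have h1 : ((q : ℤ) + 1) ∣ (i : ℤ) - j := by
      refine ⟨(p i).natDegree + i - (p j).natDegree - j, ?_⟩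
      have h2 : ((n i : ℕ) : ℤ) = n j := by rw [hij]
      simp only [hn] at h2
      push_cast at h2
      linear_combination -h2
    have h2 := Int.eq_zero_of_abs_lt_dvd h1 (by rw [abs_lt]; omega)
    omega
  set S := (Finset.range (q + 1)).filter (fun i => p i ≠ 0) with hS
  have hpS : z = ∑ i ∈ S, aeval y (p i) * x ^ i := by
    rw [hp, hS, Finset.sum_filter_of_ne]
    intro i _ hi h0
    exact hi (by rw [h0]; simp)
  by_cases hne : S.Nonempty
  · obtain ⟨j, hj, hmax⟩ := S.exists_max_image n hne
    have hj' := Finset.mem_filter.1 hj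
    have hvz : I.val z = WithZero.exp (n j : ℤ) := by
      rw [hpS, Valuation.map_sum_eq_of_lt I.val hj, hval j hj'.2]
      intro i hi
      rw [Finset.mem_sdiff, Finset.mem_singleton] at hi
      have hi' := Finset.mem_filter.1 hi.1
      rw [hval j hj'.2, hval i hi'.2, WithZero.exp_lt_exp, Nat.cast_lt]
      exact lt_of_le_of_ne (hmax i hi.1) fun h0 => hi.2
        (hinj i j (Finset.mem_range.1 hi'.1) (Finset.mem_range.1 hj'.1) h0)
    rw [hvz, ← WithZero.exp_zero, WithZero.exp_le_exp] at hzI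
    have hall : ∀ i ∈ S, i = 0 ∧ (p i).natDegree = 0 := by
      intro i hi
      have h1 : (p i).natDegree * (q + 1) + i * q = 0 := by
        have := hmax i hi
        simp only [hn] at this hzI
        omega
      have h2 := Nat.add_eq_zero_iff.1 h1
      constructor
      · exact (Nat.mul_eq_zero.1 h2.2).resolve_right (by omega)
      · exact (Nat.mul_eq_zero.1 h2.1).resolve_right (by omega)
    have hS0 : S = {0} := by
      refine Finset.eq_singleton_iff_unique_mem.2 ⟨?_, fun i hi => (hall i hi).1⟩
      rw [← (hall j hj).1]; exact hj
    refine ⟨(p 0).coeff 0, ?_⟩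
    rw [hpS, hS0, Finset.sum_singleton, pow_zero, mul_one,
      eq_C_of_natDegree_eq_zero (hall 0 (by simp [hS0])).2, aeval_C, coeff_C_zero]
  · rw [Finset.not_nonempty_iff_eq_empty] at hne
    exact ⟨0, by rw [hpS, hne]; simp⟩

variable [hq : Fact (IsPrimePow q)] [hK : Fact (Nat.card K = q ^ 2)]

theorem mem_adjoin_of_forall_ord_nonneg (h : IsHermitianPair K q x y) {I : Place K F}
    (hI : 1 < I.val y) (g : Additive Fˣ) (hg : ∀ Q : Place K F, Q ≠ I → 0 ≤ Q.ord g) :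
    (g.toMul : F) ∈ Algebra.adjoin K {x, y} :=
  h.mem_adjoin_of_forall_val_le_one fun Q _ hy => (Q.val_le_one_iff_ord g).2 <| hg Q fun hQ =>
    not_lt.2 hy (hQ ▸ hI)

theorem eq_const_of_forall_ord_nonneg (h : IsHermitianPair K q x y) (g : Additive Fˣ)
    (hg : ∀ Q : Place K F, 0 ≤ Q.ord g) : ∃ c : K, (g.toMul : F) = algebraMap K F c := by
  obtain ⟨I, -, hI⟩ := h.exists_place_infinity
  exact h.eq_const_of_mem_adjoin hq.out.two_le hI
    (h.mem_adjoin_of_forall_ord_nonneg hI g fun Q _ => hg Q) ((I.val_le_one_iff_ord g).2 (hg I))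

end IsHermitianPair

end

/-! ### The degree of a function and the number of rational places -/

section

variable {K F : Type*} [Field K] [Field F] [Algebra K F] {q : ℕ} {x y : F}

theorem Place.ord_eq_zero_of_const (P : Place K F) {f : Additive Fˣ} {c : K}
    (h : algebraMap K F c = (f.toMul : F)) : P.ord f = 0 := by
  have hc : c ≠ 0 := by
    rintro rfl
    exact f.toMul.ne_zero (by rw [← h, map_zero])
  have h1 := P.val_toMul f
  rw [← h, P.val_algebraMap hc, ← WithZero.exp_zero, WithZero.exp_inj] at h1
  omega

variable [hq : Fact (IsPrimePow q)] [hK : Fact (Nat.card K = q ^ 2)]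
variable [Fintype (RationalPlace K F)]

namespace IsHermitianPair

/-- Multiplying `g^(q+1)` by powers of the tangent lines moves all zeros and poles at rational places
to infinity; the resulting function cannot have a zero at infinity without a pole elsewhere. -/
theorem sum_ord_nonpos (h : IsHermitianPair K q x y) (g : Additive Fˣ)
    (hg : ∀ Q : Place K F, Q.degree ≠ 1 → 0 ≤ Q.ord g) :
    ∑ P : RationalPlace K F, P.1.ord g ≤ 0 := by
  classical
  obtain ⟨I, hI1, hI⟩ := h.exists_place_infinity
  choose u hu using fun P : RationalPlace K F => h.exists_divisor hI P.1 P.2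
  set G : Additive Fˣ := (q + 1) • g - ∑ P : RationalPlace K F, P.1.ord g • u P with hG
  have hord : ∀ Q : Place K F, Q.ord G = ((q : ℤ) + 1) * (Q.ord g -
      ∑ P : RationalPlace K F, P.1.ord g * Set.indicator {P.1} 1 Q +
      Set.indicator {I} 1 Q * ∑ P : RationalPlace K F, P.1.ord g) := by
    intro Q
    have h1 : ∀ P : RationalPlace K F, Q.ord (P.1.ord g • u P) =
        ((q : ℤ) + 1) * (P.1.ord g * Set.indicator {P.1} 1 Q) -
        ((q : ℤ) + 1) * Set.indicator {I} 1 Q * P.1.ord g := by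
      intro P
      rw [map_zsmul, hu, smul_eq_mul]; ring
    rw [hG, map_sub, map_nsmul, map_sum, Finset.sum_congr rfl fun P _ => h1 P,
      Finset.sum_sub_distrib, ← Finset.mul_sum, ← Finset.mul_sum, nsmul_eq_mul]
    push_cast
    ring
  -- at a rational place the tangent lines cancel the order of `g^(q+1)`
  have hrat : ∀ Q : RationalPlace K F,
      ∑ P : RationalPlace K F, P.1.ord g * Set.indicator {P.1} 1 Q.1 = Q.1.ord g := by
    intro Q
    rw [Finset.sum_eq_single Q]
    · simp
    · intro P _ hPQ
      have : Q.1 ≠ P.1 := fun h0 => hPQ (Subtype.ext h0.symm)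
      simp [this]
    · simp
  have hnonneg : ∀ Q : Place K F, Q ≠ I → 0 ≤ Q.ord G := by
    intro Q hQI
    rw [hord]
    refine mul_nonneg (by omega) ?_
    by_cases hQ : Q.degree = 1
    · rw [hrat ⟨Q, hQ⟩]; simp [hQI]
    · have h0 : ∑ P : RationalPlace K F, P.1.ord g * Set.indicator {P.1} 1 Q = 0 := by
        refine Finset.sum_eq_zero fun P _ => ?_
        have : Q ≠ P.1 := by rintro rfl; exact hQ P.2
        simp [this]
      rw [h0]
      simpa [hQI] using hg Q hQ
  have hIG : I.ord G = ((q : ℤ) + 1) * ∑ P : RationalPlace K F, P.1.ord g := by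
    rw [hord, hrat ⟨I, hI1⟩]; simp
  by_contra! hpos
  have hIpos : 0 < I.ord G := by
    rw [hIG]
    exact mul_pos (by omega) hpos
  obtain ⟨c, hc⟩ := h.eq_const_of_forall_ord_nonneg G fun Q => by
    by_cases hQI : Q = I
    · rw [hQI]; exact hIpos.le
    · exact hnonneg Q hQI
  rw [I.ord_eq_zero_of_const hc.symm] at hIpos
  exact lt_irrefl _ hIpos

/-- The product formula for functions supported in the rational places. -/
theorem sum_ord_eq_zero (h : IsHermitianPair K q x y) (f : rationalUnits K F) :
    ∑ P : RationalPlace K F, P.1.ord f.1 = 0 := by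
  have h0 : ∀ Q : Place K F, Q.degree ≠ 1 → Q.ord f.1 = 0 := fun Q hQ => by
    by_contra h1; exact hQ (f.2 Q h1)
  refine le_antisymm (h.sum_ord_nonpos f.1 fun Q hQ => (h0 Q hQ).ge) ?_
  have h1 := h.sum_ord_nonpos (-f.1) fun Q hQ => by rw [map_neg, h0 Q hQ, neg_zero]
  simp only [map_neg, Finset.sum_neg_distrib] at h1
  omega

/-- A function supported in the rational places has as many poles as zeros. -/
theorem sum_poles_eq_functionDegree (h : IsHermitianPair K q x y) (f : rationalUnits K F) :
    ∑ P : RationalPlace K F, max (-P.1.ord f.1) 0 = functionDegree f := by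
  have h0 := h.sum_ord_eq_zero f
  rw [← sub_eq_zero, functionDegree, ← Finset.sum_sub_distrib, ← neg_eq_zero, ← h0,
    ← Finset.sum_neg_distrib]
  refine Finset.sum_congr rfl fun P _ => ?_
  split_ifs <;> omega

open Classical in
/-- A function supported in the rational places takes each value at most as often as its degree. -/
theorem card_fiber_le (h : IsHermitianPair K q x y) (f : rationalUnits K F)
    (hf : ∀ c : K, algebraMap K F c ≠ f.1.toMul) (c : K) :
    ((Finset.univ.filter fun P : RationalPlace K F =>
      P.1.val ((f.1.toMul : F) - algebraMap K F c) < 1).card : ℤ) ≤ functionDegree f := by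
  let g : Additive Fˣ := Additive.ofMul
    (Units.mk0 ((f.1.toMul : F) - algebraMap K F c) (sub_ne_zero.2 (hf c).symm))
  have hgf : (g.toMul : F) = (f.1.toMul : F) - algebraMap K F c := rfl
  have hreg : ∀ Q : Place K F, 0 ≤ Q.ord f.1 → 0 ≤ Q.ord g := by
    intro Q hQ
    rw [← Q.val_le_one_iff_ord, ← Q.mem_ring_iff] at hQ ⊢
    exact sub_mem hQ (Q.algebraMap_mem c)
  have hsum := h.sum_ord_nonpos g fun Q hQ => hreg Q (by
    by_contra h1; exact hQ (f.2 Q (by omega)))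
  -- `f - c` has the same poles as `f`, with the same orders
  have hle : ∀ P : RationalPlace K F,
      (if P.1.val ((f.1.toMul : F) - algebraMap K F c) < 1 then (1 : ℤ) else 0) ≤
        P.1.ord g + max (-P.1.ord f.1) 0 := by
    intro P
    rw [← hgf]
    by_cases hP : 0 ≤ P.1.ord f.1
    · have h1 := hreg P.1 hP
      split_ifs with h2
      · rw [P.1.val_lt_one_iff_ord] at h2; omega
      · omega
    · have h1 := (P.1.one_lt_val_iff_ord f.1).2 (not_le.1 hP)
      have h2 : P.1.val (g.toMul : F) = P.1.val (f.1.toMul : F) :=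
        Valuation.map_sub_eq_of_lt_left _ ((P.1.val_algebraMap_le_one c).trans_lt h1)
      rw [h2, if_neg (not_lt.2 h1.le)]
      rw [P.1.val_toMul, P.1.val_toMul, WithZero.exp_inj] at h2
      omega
  rw [← Finset.sum_boole]
  calc _ ≤ ∑ P : RationalPlace K F, (P.1.ord g + max (-P.1.ord f.1) 0) :=
        Finset.sum_le_sum fun P _ => hle P
    _ ≤ functionDegree f := by
        rw [Finset.sum_add_distrib, h.sum_poles_eq_functionDegree]; omega

open Classical in
theorem card_poles_le (h : IsHermitianPair K q x y) (f : rationalUnits K F) :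
    ((Finset.univ.filter fun P : RationalPlace K F => 1 < P.1.val (f.1.toMul : F)).card : ℤ) ≤
      functionDegree f := by
  rw [← Finset.sum_boole, ← h.sum_poles_eq_functionDegree]
  refine Finset.sum_le_sum fun P _ => ?_
  split_ifs with h1
  · rw [P.1.one_lt_val_iff_ord] at h1; omega
  · exact le_max_right _ _

/-- A nonconstant function supported in the rational places takes each of the `q^2 + 1` values in
`K ∪ {∞}` at most as often as its degree. -/
theorem card_rationalPlace_le (h : IsHermitianPair K q x y) (f : rationalUnits K F)
    (hf : ∀ c : K, algebraMap K F c ≠ f.1.toMul) :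
    (Fintype.card (RationalPlace K F) : ℤ) ≤ ((q : ℤ) ^ 2 + 1) * functionDegree f := by
  classical
  have : Finite K := Nat.finite_of_card_ne_zero (by
    rw [hK.out]; exact pow_ne_zero _ hq.out.ne_zero)
  have := Fintype.ofFinite K
  have hcover : (Finset.univ : Finset (RationalPlace K F)) ⊆
      (Finset.univ.filter fun P : RationalPlace K F => 1 < P.1.val (f.1.toMul : F)) ∪
      (Finset.univ : Finset K).biUnion fun c => Finset.univ.filter fun P : RationalPlace K F =>
        P.1.val ((f.1.toMul : F) - algebraMap K F c) < 1 := by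
    intro P _
    rw [Finset.mem_union, Finset.mem_filter, Finset.mem_biUnion]
    by_cases hP : 1 < P.1.val (f.1.toMul : F)
    · exact Or.inl ⟨Finset.mem_univ _, hP⟩
    · obtain ⟨c, hc⟩ := P.1.exists_const P.2 _ (not_lt.1 hP)
      exact Or.inr ⟨c, Finset.mem_univ _, Finset.mem_filter.2 ⟨Finset.mem_univ _, hc⟩⟩
  have h1 := (Finset.card_le_card hcover).trans
    ((Finset.card_union_le _ _).trans (Nat.add_le_add_left Finset.card_biUnion_le _))
  have h2 : (Fintype.card (RationalPlace K F) : ℤ) ≤ functionDegree f +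
      ∑ c : K, functionDegree f := by
    refine (Int.ofNat_le.2 h1).trans ?_
    push_cast
    exact add_le_add (h.card_poles_le f) (Finset.sum_le_sum fun c _ => h.card_fiber_le f hf c)
  rw [Finset.sum_const, Finset.card_univ, ← Nat.card_eq_fintype_card (α := K), hK.out, nsmul_eq_mul] at h2
  push_cast at h2
  linarith

end IsHermitianPair

end

/-! ### Rational places over a given value of `x` -/

section

variable {K F : Type*} [Field K] [Field F] [Algebra K F] {q : ℕ} {x y : F}

theorem Place.not_val_sub_lt_one (P : Place K F) {a a' : K} (hne : a ≠ a')
    (ha : P.val (x - algebraMap K F a) < 1) : ¬ P.val (x - algebraMap K F a') < 1 := by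
  intro ha'
  have h3 := P.val.map_sub_lt ha' ha
  rw [sub_sub_sub_cancel_left, ← map_sub] at h3
  exact hne (sub_eq_zero.1 (P.eq_zero_of_val_algebraMap_lt_one h3))

theorem natDegree_X_pow_add_X_sub_C (hq2 : 2 ≤ q) (c : K) :
    (X ^ q + X - C c : K[X]).natDegree = q := by
  rw [natDegree_sub_C, natDegree_add_eq_left_of_natDegree_lt] <;> simp
  omega

theorem monic_X_pow_add_X_sub_C (hq2 : 2 ≤ q) (c : K) : (X ^ q + X - C c : K[X]).Monic := by
  rw [add_sub_assoc]
  refine monic_X_pow_add ((degree_sub_le _ _).trans_lt ?_)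
  refine max_lt (degree_X_le.trans_lt (by exact_mod_cast hq2)) (degree_C_le.trans_lt ?_)
  exact_mod_cast (by omega : 0 < q)

variable [hq : Fact (IsPrimePow q)] [hK : Fact (Nat.card K = q ^ 2)]

/-- The trace `b ↦ b^q + b` from `𝔽_{q²}` to `𝔽_q` takes every value `q` times. Its fibres and its
range have at most `q` elements each, and `q²` elements in total. -/
theorem card_roots_X_pow_add_X_sub_C {c : K} (hc : c ^ q = c) :
    Multiset.card (X ^ q + X - C c : K[X]).roots = q ∧ (X ^ q + X - C c : K[X]).roots.Nodup := by
  classical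
  have hq2 : 2 ≤ q := hq.out.two_le
  have : Finite K := Nat.finite_of_card_ne_zero (by
    rw [hK.out]; exact pow_ne_zero _ hq.out.ne_zero)
  have := Fintype.ofFinite K
  set φ : K → K := fun b => b ^ q + b with hφ
  set T : Finset K := Finset.univ.filter fun c => c ^ q = c with hT
  have hmem : ∀ c b : K, b ∈ (X ^ q + X - C c : K[X]).roots ↔ φ b = c := by
    intro c b
    rw [mem_roots (monic_X_pow_add_X_sub_C hq2 c).ne_zero]
    simp [hφ, IsRoot.def, sub_eq_zero]
  have hfib_le : ∀ c : K, (Finset.univ.filter fun b => φ b = c).card ≤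
      (X ^ q + X - C c : K[X]).roots.toFinset.card := fun c =>
    Finset.card_le_card fun b hb => by
      rw [Multiset.mem_toFinset, hmem]; exact (Finset.mem_filter.1 hb).2
  have hroots : ∀ c : K, Multiset.card (X ^ q + X - C c : K[X]).roots ≤ q := fun c =>
    (card_roots' _).trans_eq (natDegree_X_pow_add_X_sub_C hq2 c)
  have hfib : ∀ c : K, (Finset.univ.filter fun b => φ b = c).card ≤ q := fun c =>
    (hfib_le c).trans ((Multiset.toFinset_card_le _).trans (hroots c))
  have hTcard : T.card ≤ q := by
    have hdeg : (X ^ q - X : K[X]).natDegree = q := by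
      rw [natDegree_sub_eq_left_of_natDegree_lt] <;> simp
      omega
    have hne : (X ^ q - X : K[X]) ≠ 0 := fun h0 => by
      rw [h0, natDegree_zero] at hdeg; omega
    refine (Finset.card_le_card (t := (X ^ q - X : K[X]).roots.toFinset) fun c hc => ?_).trans
      ((Multiset.toFinset_card_le _).trans ((card_roots' _).trans_eq hdeg))
    rw [Multiset.mem_toFinset, mem_roots hne]
    simpa [IsRoot.def, sub_eq_zero] using (Finset.mem_filter.1 hc).2
  have hmaps : ∀ b ∈ (Finset.univ : Finset K), φ b ∈ T := by
    intro b _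
    rw [hT, Finset.mem_filter]
    refine ⟨Finset.mem_univ _, ?_⟩
    rw [hφ]
    dsimp only
    rw [HermitianFunctionField.frobenius_add K q K, pow_card_sq, add_comm]
  have hsum := Finset.card_eq_sum_card_fiberwise hmaps
  rw [Finset.card_univ, ← Nat.card_eq_fintype_card, hK.out] at hsum
  have hfibc : (Finset.univ.filter fun b => φ b = c).card = q := by
    refine le_antisymm (hfib c) ?_
    by_contra! hlt
    have h1 : ∑ c ∈ T, (Finset.univ.filter fun b => φ b = c).card < ∑ c ∈ T, q :=
      Finset.sum_lt_sum (fun c _ => hfib c)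
        ⟨c, Finset.mem_filter.2 ⟨Finset.mem_univ _, hc⟩, hlt⟩
    rw [Finset.sum_const, smul_eq_mul, ← hsum] at h1
    nlinarith
  have h1 := hfib_le c
  have h2 := Multiset.toFinset_card_le (X ^ q + X - C c : K[X]).roots
  have h3 := hroots c
  refine ⟨by omega, ?_⟩
  rw [← Multiset.toFinset_card_eq_card_iff_nodup]
  omega

theorem norm_pow (a : K) : (a ^ (q + 1)) ^ q = a ^ (q + 1) := by
  rw [← pow_mul, mul_comm, pow_mul, pow_succ, pow_card_sq, mul_comm, ← pow_succ]

namespace IsHermitianPair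

theorem exists_rationalPlace (h : IsHermitianPair K q x y) {a b : K}
    (hab : b ^ q + b = a ^ (q + 1)) : ∃ P : RationalPlace K F,
      P.1.val (x - algebraMap K F a) < 1 ∧ P.1.val (y - algebraMap K F b) < 1 := by
  obtain ⟨P, hP, hx, hw⟩ := (h.translate hab).exists_place
  exact ⟨⟨P, hP⟩, hx, (val_tangent_lt_one_iff hab hx).1 hw⟩

theorem eq_of_center (h : IsHermitianPair K q x y) {a b : K} (hab : b ^ q + b = a ^ (q + 1))
    {P Q : Place K F} (hPa : P.val (x - algebraMap K F a) < 1)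
    (hPb : P.val (y - algebraMap K F b) < 1) (hQa : Q.val (x - algebraMap K F a) < 1)
    (hQb : Q.val (y - algebraMap K F b) < 1) : P = Q :=
  (h.translate hab).place_unique hq.out.two_le hPa ((val_tangent_lt_one_iff hab hPa).2 hPb)
    hQa ((val_tangent_lt_one_iff hab hQa).2 hQb)

/-- Over a constant value `a` of `x`, the equation `y^q + y = a^(q+1)` splits over `K`, so that `y`
takes a constant value too. -/
theorem exists_val_sub_lt_one (h : IsHermitianPair K q x y) {a : K} {P : Place K F}
    (ha : P.val (x - algebraMap K F a) < 1) :
    ∃ b : K, b ^ q + b = a ^ (q + 1) ∧ P.val (y - algebraMap K F b) < 1 := by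
  have hq2 : 2 ≤ q := hq.out.two_le
  have hx : P.val x ≤ 1 := by
    rw [← sub_add_cancel x (algebraMap K F a), ← P.mem_ring_iff]
    exact add_mem ((P.mem_ring_iff _).2 ha.le) (P.algebraMap_mem a)
  have hy := h.val_snd_le_one hq2 P hx
  set G : K[X] := X ^ q + X - C (a ^ (q + 1)) with hG
  have hmonic : G.Monic := monic_X_pow_add_X_sub_C hq2 _
  have hcard := (card_roots_X_pow_add_X_sub_C (q := q) (norm_pow a)).1
  have hprod := prod_multiset_X_sub_C_of_monic_of_roots_card_eq hmonic
    (hcard.trans (natDegree_X_pow_add_X_sub_C hq2 _).symm)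
  have hlt : P.val (aeval y G) < 1 := by
    have h1 : aeval y G = x ^ q * (x - algebraMap K F a) +
        algebraMap K F a * (x - algebraMap K F a) ^ q := by
      simp only [hG, map_sub, map_add, map_pow, aeval_X, aeval_C, frobenius_sub (K := K)]
      rw [h.equation, pow_succ, pow_succ]
      ring
    rw [h1]
    refine P.val.map_add_lt ?_ ?_
    · rw [mul_comm, map_mul, map_pow]
      exact mul_lt_one_of_lt_of_le ha (pow_le_one₀ zero_le hx)
    · rw [mul_comm, map_mul, map_pow]
      exact mul_lt_one_of_lt_of_le (pow_lt_one₀ zero_le ha (by omega))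
        (P.val_algebraMap_le_one a)
  by_contra! hno
  have hone : ∀ b ∈ G.roots, P.val (y - algebraMap K F b) = 1 := by
    intro b hb
    refine le_antisymm ?_ (hno b ?_)
    · rw [← P.mem_ring_iff]
      exact sub_mem ((P.mem_ring_iff _).2 hy) (P.algebraMap_mem b)
    · have h1 := (mem_roots hmonic.ne_zero).1 hb
      simpa [hG, IsRoot.def, sub_eq_zero] using h1
  rw [← hprod, map_multiset_prod, map_multiset_prod, Multiset.map_map, Multiset.map_map,
    Multiset.prod_eq_one] at hlt
  · exact lt_irrefl _ hlt
  · intro v hv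
    obtain ⟨b, hb, rfl⟩ := Multiset.mem_map.1 hv
    simpa using hone b hb

theorem degree_eq_one_of_val_sub_lt_one (h : IsHermitianPair K q x y) {a : K} {P : Place K F}
    (ha : P.val (x - algebraMap K F a) < 1) : P.degree = 1 := by
  obtain ⟨b, hab, hb⟩ := h.exists_val_sub_lt_one ha
  obtain ⟨Q, hQa, hQb⟩ := h.exists_rationalPlace hab
  rw [h.eq_of_center hab ha hb hQa hQb]
  exact Q.2

theorem val_sub_eq_exp (h : IsHermitianPair K q x y) {a : K} {P : Place K F}
    (ha : P.val (x - algebraMap K F a) < 1) :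
    P.val (x - algebraMap K F a) = WithZero.exp (-1 : ℤ) := by
  obtain ⟨b, hab, hb⟩ := h.exists_val_sub_lt_one ha
  exact (h.translate hab).val_fst hq.out.two_le ha ((val_tangent_lt_one_iff hab ha).2 hb)

open Classical in
/-- The function `x / (x - 1)` has simple zeros at the `q` places over `x = 0`, simple poles at the
`q` places over `x = 1`, and no others: the poles of `x` and `x - 1` at infinity cancel. -/
theorem exists_ord_eq (h : IsHermitianPair K q x y) : ∃ f : rationalUnits K F,
    ∀ P : Place K F, P.ord f.1 = (if P.val (x - algebraMap K F 0) < 1 then 1 else 0) -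
      (if P.val (x - algebraMap K F 1) < 1 then 1 else 0) := by
  have hq2 : 2 ≤ q := hq.out.two_le
  have hne : ∀ a : K, x - algebraMap K F a ≠ 0 := fun a h0 =>
    h.transcendental_fst hq2 (by rw [sub_eq_zero.1 h0]; exact isAlgebraic_algebraMap a)
  let u : K → Additive Fˣ := fun a => Additive.ofMul (Units.mk0 _ (hne a))
  have hu : ∀ (a : K) (P : Place K F), P.val x ≤ 1 →
      P.ord (u a) = if P.val (x - algebraMap K F a) < 1 then 1 else 0 := by
    intro a P hx
    have h1 := P.val_toMul (u a)
    change P.val (x - algebraMap K F a) = _ at h1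
    split_ifs with ha
    · rw [h.val_sub_eq_exp ha, WithZero.exp_inj] at h1
      omega
    · have h2 : P.val (x - algebraMap K F a) ≤ 1 := by
        rw [← P.mem_ring_iff]
        exact sub_mem ((P.mem_ring_iff _).2 hx) (P.algebraMap_mem a)
      rw [le_antisymm h2 (not_lt.1 ha), ← WithZero.exp_zero, WithZero.exp_inj] at h1
      omega
  have hinf : ∀ (a : K) (P : Place K F), 1 < P.val x → P.val (x - algebraMap K F a) = P.val x :=
    fun a P hx => Valuation.map_sub_eq_of_lt_left _ ((P.val_algebraMap_le_one a).trans_lt hx)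
  have hord : ∀ P : Place K F, P.ord (u 0 - u 1) =
      (if P.val (x - algebraMap K F 0) < 1 then 1 else 0) -
      (if P.val (x - algebraMap K F 1) < 1 then 1 else 0) := by
    intro P
    rw [map_sub]
    by_cases hx : P.val x ≤ 1
    · rw [hu 0 P hx, hu 1 P hx]
    · rw [not_le] at hx
      have h0 := P.val_toMul (u 0)
      have h1 := P.val_toMul (u 1)
      change P.val (x - algebraMap K F 0) = _ at h0
      change P.val (x - algebraMap K F 1) = _ at h1
      rw [hinf 0 P hx] at h0
      rw [hinf 1 P hx, h0, WithZero.exp_inj] at h1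
      rw [hinf 0 P hx, hinf 1 P hx, if_neg (not_lt.2 hx.le)]
      omega
  refine ⟨⟨u 0 - u 1, fun P hP => ?_⟩, hord⟩
  rw [hord] at hP
  by_cases h0 : P.val (x - algebraMap K F 0) < 1
  · exact h.degree_eq_one_of_val_sub_lt_one h0
  · by_cases h1 : P.val (x - algebraMap K F 1) < 1
    · exact h.degree_eq_one_of_val_sub_lt_one h1
    · rw [if_neg h0, if_neg h1] at hP
      exact absurd (sub_self 0) hP

variable [Fintype (RationalPlace K F)]

open Classical in
theorem card_zeros_sub (h : IsHermitianPair K q x y) (a : K) :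
    (Finset.univ.filter fun P : RationalPlace K F =>
      P.1.val (x - algebraMap K F a) < 1).card = q := by
  have hq2 : 2 ≤ q := hq.out.two_le
  obtain ⟨hcard, hnodup⟩ := card_roots_X_pow_add_X_sub_C (q := q) (norm_pow a)
  have hmem : ∀ b : K, b ∈ (X ^ q + X - C (a ^ (q + 1)) : K[X]).roots.toFinset ↔
      b ^ q + b = a ^ (q + 1) := by
    intro b
    rw [Multiset.mem_toFinset, mem_roots (monic_X_pow_add_X_sub_C hq2 _).ne_zero]
    simp only [IsRoot.def, eval_sub, eval_add, eval_pow, eval_X, eval_C, sub_eq_zero]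
  rw [← Multiset.toFinset_card_of_nodup hnodup] at hcard
  rw [← hcard]
  symm
  refine Finset.card_bij
    (fun b hb => (h.exists_rationalPlace ((hmem b).1 hb)).choose) ?_ ?_ ?_
  · intro b hb
    exact Finset.mem_filter.2 ⟨Finset.mem_univ _,
      (h.exists_rationalPlace ((hmem b).1 hb)).choose_spec.1⟩
  · intro b hb b' hb' heq
    have h1 := (h.exists_rationalPlace ((hmem b).1 hb)).choose_spec.2
    have h2 := (h.exists_rationalPlace ((hmem b').1 hb')).choose_spec.2
    rw [← heq] at h2
    have h3 := Valuation.map_sub_lt _ h2 h1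
    rw [sub_sub_sub_cancel_left, ← map_sub] at h3
    exact sub_eq_zero.1 (Place.eq_zero_of_val_algebraMap_lt_one _ h3)
  · intro P hP
    have hPa := (Finset.mem_filter.1 hP).2
    obtain ⟨b, hab, hb⟩ := h.exists_val_sub_lt_one hPa
    have hs := (h.exists_rationalPlace hab).choose_spec
    exact ⟨b, (hmem b).2 hab, Subtype.ext (h.eq_of_center hab hs.1 hs.2 hPa hb)⟩

theorem le_card_rationalPlace (h : IsHermitianPair K q x y) :
    q ^ 3 ≤ Fintype.card (RationalPlace K F) := by
  classical
  have : Finite K := Nat.finite_of_card_ne_zero (by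
    rw [hK.out]; exact pow_ne_zero _ hq.out.ne_zero)
  have := Fintype.ofFinite K
  have hdisj : (Set.univ : Set K).PairwiseDisjoint fun a =>
      Finset.univ.filter fun P : RationalPlace K F => P.1.val (x - algebraMap K F a) < 1 := by
    intro a _ a' _ hne
    refine Finset.disjoint_left.2 fun P hP hP' => ?_
    exact P.1.not_val_sub_lt_one hne (Finset.mem_filter.1 hP).2 (Finset.mem_filter.1 hP').2
  have h1 := Finset.card_biUnion (s := (Finset.univ : Finset K)) (by simpa using hdisj)
  rw [Finset.sum_congr rfl fun a _ => h.card_zeros_sub a, Finset.sum_const, Finset.card_univ,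
    ← Nat.card_eq_fintype_card (α := K), hK.out, smul_eq_mul, ← pow_succ] at h1
  rw [← h1]
  exact Finset.card_le_univ _

theorem le_functionDegree (h : IsHermitianPair K q x y) (f : rationalUnits K F)
    (hf : ∀ c : K, algebraMap K F c ≠ f.1.toMul) : (q : ℤ) ≤ functionDegree f := by
  have h1 := h.card_rationalPlace_le f hf
  have h2 : ((q ^ 3 : ℕ) : ℤ) ≤ Fintype.card (RationalPlace K F) :=
    Int.ofNat_le.2 h.le_card_rationalPlace
  have hq2 : (2 : ℤ) ≤ q := by exact_mod_cast hq.out.two_le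
  push_cast at h2
  -- `(q - 1) (q^2 + 1) < q^3`
  by_contra! hlt
  have h3 : functionDegree f ≤ q - 1 := by omega
  have h4 : ((q : ℤ) ^ 2 + 1) * functionDegree f ≤ ((q : ℤ) ^ 2 + 1) * (q - 1) :=
    mul_le_mul_of_nonneg_left h3 (by nlinarith)
  nlinarith

theorem exists_functionDegree_eq (h : IsHermitianPair K q x y) : ∃ f : rationalUnits K F,
    (∀ c : K, algebraMap K F c ≠ f.1.toMul) ∧ functionDegree f = q ∧
      ∑ P : RationalPlace K F, P.1.ord f.1 ^ 2 = 2 * q := by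
  classical
  obtain ⟨f, hf⟩ := h.exists_ord_eq
  have hex : ∀ P : Place K F, P.val (x - algebraMap K F 0) < 1 →
      ¬ P.val (x - algebraMap K F 1) < 1 := fun P hP => P.not_val_sub_lt_one zero_ne_one hP
  have hcard : ∀ a : K, ∑ P : RationalPlace K F,
      (if P.1.val (x - algebraMap K F a) < 1 then (1 : ℤ) else 0) = q := fun a => by
    rw [Finset.sum_boole, h.card_zeros_sub a]
  have hdeg : functionDegree f = q := by
    rw [functionDegree, ← hcard 0]
    refine Finset.sum_congr rfl fun P _ => ?_
    rw [hf]
    by_cases h0 : P.1.val (x - algebraMap K F 0) < 1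
    · rw [if_pos h0, if_neg (hex P.1 h0)]; norm_num
    · rw [if_neg h0]; split_ifs <;> omega
  refine ⟨f, fun c hc => ?_, hdeg, ?_⟩
  · have h0 : functionDegree f = 0 := Finset.sum_eq_zero fun P _ => by
      rw [P.1.ord_eq_zero_of_const hc]; simp
    have := hq.out.two_le
    omega
  · rw [two_mul]
    nth_rewrite 1 [← hcard 0]
    rw [← hcard 1, ← Finset.sum_add_distrib]
    refine Finset.sum_congr rfl fun P _ => ?_
    rw [hf]
    by_cases h0 : P.1.val (x - algebraMap K F 0) < 1
    · rw [if_pos h0, if_neg (hex P.1 h0)]; norm_num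
    · rw [if_neg h0]; split_ifs <;> norm_num

/-! ### Norms of lattice vectors -/

theorem norm_divisorVector (f : rationalUnits K F) :
    ‖divisorVector K F f‖ = √((∑ P : RationalPlace K F, P.1.ord f.1 ^ 2 : ℤ) : ℝ) := by
  rw [EuclideanSpace.norm_eq]
  push_cast
  congr 1
  refine Finset.sum_congr rfl fun P _ => ?_
  rw [Real.norm_eq_abs, sq_abs]
  rfl

/-- The squared norm bounds the `ℓ¹`-norm, which is twice the degree by the product formula. -/
theorem two_mul_functionDegree_le (h : IsHermitianPair K q x y) (f : rationalUnits K F) :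
    2 * functionDegree f ≤ ∑ P : RationalPlace K F, P.1.ord f.1 ^ 2 := by
  rw [two_mul]
  nth_rewrite 1 [← h.sum_poles_eq_functionDegree f]
  rw [functionDegree, ← Finset.sum_add_distrib]
  refine Finset.sum_le_sum fun P _ => ?_
  generalize P.1.ord f.1 = n
  have h1 : |n| ≤ n ^ 2 := by
    rw [← sq_abs]
    rcases (abs_nonneg n).eq_or_lt with h0 | h0
    · rw [← h0]; simp
    · nlinarith
  rcases abs_cases n with ⟨h2, h3⟩ | ⟨h2, h3⟩ <;> split_ifs <;> omega

theorem isLeast_norm (h : IsHermitianPair K q x y) :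
    IsLeast {r : ℝ | ∃ v ∈ lattice K F, v ≠ 0 ∧ ‖v‖ = r} (√(2 * q)) := by
  constructor
  · obtain ⟨f, -, -, hsum⟩ := h.exists_functionDegree_eq
    have hnorm : ‖divisorVector K F f‖ = √(2 * q) := by
      rw [norm_divisorVector, hsum]
      push_cast
      rfl
    refine ⟨_, ⟨f, rfl⟩, fun h0 => ?_, hnorm⟩
    rw [h0, norm_zero] at hnorm
    have : (0 : ℝ) < q := by exact_mod_cast hq.out.pos
    exact (Real.sqrt_pos.2 (by positivity)).ne hnorm
  · rintro r ⟨_, ⟨f, rfl⟩, hv, rfl⟩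
    rw [norm_divisorVector]
    refine Real.sqrt_le_sqrt ?_
    have h1 := h.two_mul_functionDegree_le f
    have h2 := h.le_functionDegree f fun c hc => hv <| by
      ext P
      change ((P.1.ord f.1 : ℤ) : ℝ) = 0
      rw [P.1.ord_eq_zero_of_const hc, Int.cast_zero]
    have h3 : 2 * (q : ℤ) ≤ ∑ P : RationalPlace K F, P.1.ord f.1 ^ 2 := by omega
    exact_mod_cast h3

theorem isLeast_functionDegree (h : IsHermitianPair K q x y) :
    IsLeast {d : ℤ | ∃ f : rationalUnits K F,
      (∀ c : K, algebraMap K F c ≠ f.1.toMul) ∧ functionDegree f = d} q := by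
  constructor
  · obtain ⟨f, hf, hd, -⟩ := h.exists_functionDegree_eq
    exact ⟨f, hf, hd⟩
  · rintro d ⟨f, hf, rfl⟩
    exact h.le_functionDegree f hf

end IsHermitianPair

end

end FunctionFieldLattice

namespace HermitianFunctionField

open FunctionFieldLattice

theorem isHermitianPair (K : Type*) [Field K] (q : ℕ) [Fact (IsPrimePow q)] :
    IsHermitianPair K q (x K q) (y K q) where
  equation := equation K q
  adjoin_eq_top := adjoin_eq_top K q _ (IntermediateField.subset_adjoin _ _ (by simp))
    (IntermediateField.subset_adjoin _ _ (by simp))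
  transcendental := by
    have h : Transcendental K (RatFunc.X : RatFunc K) := RatFunc.transcendental_X
    exact (transcendental_algebraMap_iff
      (algebraMap (RatFunc K) (HermitianFunctionField K q)).injective).2 h

end HermitianFunctionField

open FunctionFieldLattice in
theorem mainTheorem2 (K : Type*) [Field K] (q : ℕ) [Fact (IsPrimePow q)]
    [Fact (Nat.card K = q ^ 2)] :
    IsLeast {r : ℝ | ∃ v ∈ lattice K (HermitianFunctionField K q), v ≠ 0 ∧ ‖v‖ = r}
      (Real.sqrt (2 * q)) ∧
    IsLeast {d : ℤ | ∃ f : rationalUnits K (HermitianFunctionField K q),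
      (∀ c : K, algebraMap K (HermitianFunctionField K q) c ≠ f.1.toMul) ∧ functionDegree f = d} q :=
  ⟨(HermitianFunctionField.isHermitianPair K q).isLeast_norm,
    (HermitianFunctionField.isHermitianPair K q).isLeast_functionDegree⟩
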